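/- **Setting.** Let $\alpha\ge 0$, $g\in\mathbb R$, $\Lambda\in(0,\infty)$, $m\ge 0$ and $\omega(k)=\sqrt{|k|^2+m^2}$ (so $\omega(k)=|k|$ if $m=0$). Let $\mathcal F$ be the bosonic Fock space over $L^2(\mathbb R^3;\mathbb C^2)$ (photons with two polarizations), with annihilation and creation operators $a_\lambda(k),a^*_\lambda(k)$ satisfying $[a_\lambda(k),a^*_\nu(q)]=\delta(k-q)\delta_{\lambda\nu}$, and let $$H_f=\sum_{\lambda=1,2}\int_{\mathbb R^3}\omega(k)\,a^*_\lambda(k)a_\lambda(k)\,d^3k,\qquad A(x)=\sum_{\lambda=1,2}\int_{|k|<\Lambda}\frac{\varepsilon_\lambda(k)}{\sqrt{|k|}}\left[a_\lambda(k)e^{ik\cdot x}+a_\lambda^*(k)e^{-ik\cdot x}\right]d^3k,\qquad B=\operatorname{curl}A,$$ with polarization vectors $\varepsilon_1(k)=(k_2,-k_1,0)/\sqrt{k_1^2+k_2^2}$ and $\varepsilon_2(k)=\frac{k}{|k|}\wedge\varepsilon_1(k)$. For $N\ge 1$, a one-body potential $v:\mathbb R^3\to\mathbb R$ and an interaction $I:\mathbb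 R^{3N}\to\mathbb R$ consider, on the vectors of $\bigotimes^N L^2(\mathbb R^3;\mathbb C^2)\otimes\mathcal F$ that are antisymmetric in the $N$ particles, $$H^V=\sum_{j=1}^N\left\{\left(p_j+\sqrt\alpha A(x_j)\right)^2+\frac g2\sqrt\alpha\,\sigma_j\cdot B(x_j)\right\}+\sum_{j=1}^N v(x_j)+I(x_1,\dots,x_N)+H_f ,\qquad p_j=-i\nabla_j ,$$ where $\sigma_j$ are the Pauli matrices of the $j$-th spin. Let $E^V(N)$ be its ground state energy, the infimum of the quadratic form $(\Psi,H^V\Psi)$ over the normalized antisymmetric $\Psi$ that are finite linear combinations of products of a function in $C_c^\infty(\mathbb R^{3N})$, a spin vector, and a vector of $\mathcal F$ with finitely many photons and finite field energy. (If the form is bounded below this is the bottom of the spectrum of the Friedrichs extension of $H^V$; otherwise it is $-\infty$.) Let $E^0(N)$ be the same quantity with $v=0$ and the same $I$. **Assumptions.** $v$ is locally integrable, and its negative part $v_-=\max(-v,0)$ is form bounded with respect to $p^2$ with arbitrarily small bound: for every $\varepsilon>0$ there is $a(\varepsilon)$ with $v_-\le\varepsilon p^2+a(\varepsilon)$ as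 quadratic forms on $C_c^\infty(\mathbb R^3)$. $I$ is locally integrable, invariant under common translations of all particles, and symmetric in the particle labels. **Theorem (Binding of at least one particle).** Suppose that the Friedrichs extension of $p^2+v$ on $L^2(\mathbb R^3)$ has a bound state of negative energy: an eigenfunction $\phi\neq0$ with eigenvalue $-e_0<0$. Then $$E^V(1)\le E^0(1)-e_0 .$$ If in addition $v(x)\le 0$ for all $x$, then for every $N\ge 1$ $$E^V(N)\le E^0(N)-e_0 .$$ -/

import Mathlib

open scoped ContDiff ComplexConjugate

/-! # Non-relativistic quantum electrodynamics of `N` spin-1/2 fermions -/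

namespace QED

noncomputable section

/-- Physical space, and photon momentum space, `ℝ³`. -/
abbrev E3 := EuclideanSpace ℝ (Fin 3)

/-- Positions `X = (x₁, …, x_N)` of `N` particles. -/
abbrev Config (N : ℕ) := Fin N → E3

/-- Values `σ = (σ₁, …, σ_N)` of the `N` spin variables. -/
abbrev Spins (N : ℕ) := Fin N → Fin 2

/-! ## One-particle Schrödinger operator `p² + v` -/

/-- `ψ ∈ C_c^∞(Y; ℂ)`. -/
def IsTest {Y : Type*} [NormedAddCommGroup Y] [NormedSpace ℝ Y] (ψ : Y → ℂ) : Prop :=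
  ContDiff ℝ ∞ ψ ∧ HasCompactSupport ψ

/-- The partial derivative `∂ψ/∂x_a` on `ℝ³`. -/
def partialDeriv (a : Fin 3) (ψ : E3 → ℂ) (x : E3) : ℂ :=
  lineDeriv ℝ ψ x (EuclideanSpace.single a 1)

/-- The sesquilinear form `(ψ, (p² + v) φ)` on test functions, `p = -i∇`. -/
def schrodingerForm (v : E3 → ℝ) (ψ φ : E3 → ℂ) : ℂ :=
  (∑ a : Fin 3, ∫ x, conj (partialDeriv a ψ x) * partialDeriv a φ x)
    + ∫ x, (v x : ℂ) * (conj (ψ x) * φ x)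

/-- The negative part `v₋ = max(-v, 0)` is form bounded with respect to `p²` with
arbitrarily small bound: for each `ε > 0` there is `a` with `v₋ ≤ ε p² + a`. -/
def NegPartFormBounded (v : E3 → ℝ) : Prop :=
  ∀ ε : ℝ, 0 < ε → ∃ a : ℝ, ∀ ψ : E3 → ℂ, IsTest ψ →
    ∫ x, max (-(v x)) 0 * ‖ψ x‖ ^ 2
      ≤ ε * (∑ b : Fin 3, ∫ x, ‖partialDeriv b ψ x‖ ^ 2) + a * ∫ x, ‖ψ x‖ ^ 2

/-- `φ` is an eigenfunction, with eigenvalue `E`, of the Friedrichs extension of `p² + v` on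
`C_c^∞(ℝ³)`. The first three conditions on the sequence `u` say that `φ` lies in the form
domain, i.e. in the closure of the test functions in the form norm, and that `u` converges to
`φ` in it; the last one is the eigenvalue equation `(ψ, (p² + v) φ) = E (ψ, φ)`, tested with
the functions `ψ` of the form core. -/
def IsBoundState (v : E3 → ℝ) (E : ℝ) (φ : E3 → ℂ) : Prop :=
  MeasureTheory.MemLp φ 2 MeasureTheory.volume ∧
  ¬ (φ =ᵐ[MeasureTheory.volume] 0) ∧
  ∃ u : ℕ → E3 → ℂ,
    (∀ n, IsTest (u n)) ∧
    Filter.Tendsto (fun n => MeasureTheory.eLpNorm (u n - φ) 2 MeasureTheory.volume)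
      Filter.atTop (nhds 0) ∧
    (∀ ε : ℝ, 0 < ε → ∃ M : ℕ, ∀ n ≥ M, ∀ m ≥ M,
      ‖schrodingerForm v (u n - u m) (u n - u m)‖ < ε) ∧
    (∀ ψ : E3 → ℂ, IsTest ψ →
      Filter.Tendsto (fun n => schrodingerForm v ψ (u n)) Filter.atTop
        (nhds ((E : ℂ) * ∫ x, conj (ψ x) * φ x)))

/-! ## Photon Fock space -/

/-- A (representative of a) vector of the photon Fock space: for every number `n` of photons
an amplitude, depending on the momenta `k₁, …, k_n` and polarizations `λ₁, …, λ_n`. -/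
abbrev Fock := (n : ℕ) → (Fin n → E3) → (Fin n → Fin 2) → ℂ

/-- Inner product of the Fock space. -/
def fockInner (η ζ : Fock) : ℂ :=
  ∑' n : ℕ, ∑ l : Fin n → Fin 2, ∫ k : Fin n → E3, conj (η n k l) * ζ n k l

/-- Squared norm of the Fock space. -/
def fockNormSq (η : Fock) : ℝ :=
  ∑' n : ℕ, ∑ l : Fin n → Fin 2, ∫ k : Fin n → E3, ‖η n k l‖ ^ 2

/-- Photon energy `ω(k) = √(k² + m²)`; the physical case `ω(k) = |k|` is `m = 0`. -/
def omega (m : ℝ) (k : E3) : ℝ := Real.sqrt (‖k‖ ^ 2 + m ^ 2)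

/-- Expectation value `(η, H_f η)` of the field energy. -/
def fieldEnergy (m : ℝ) (η : Fock) : ℝ :=
  ∑' n : ℕ, ∑ l : Fin n → Fin 2, ∫ k : Fin n → E3, (∑ i, omega m (k i)) * ‖η n k l‖ ^ 2

/-- Vectors of the bosonic Fock space with finitely many photons and finite field energy. -/
def IsFiniteFock (m : ℝ) (η : Fock) : Prop :=
  (∃ M : ℕ, ∀ n ≥ M, η n = 0) ∧
  (∀ (n : ℕ) (π : Equiv.Perm (Fin n)) (k : Fin n → E3) (l : Fin n → Fin 2),
    η n (k ∘ π) (l ∘ π) = η n k l) ∧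
  (∀ (n : ℕ) (l : Fin n → Fin 2),
    MeasureTheory.MemLp (fun k => η n k l) 2 MeasureTheory.volume) ∧
  (∀ (n : ℕ) (l : Fin n → Fin 2),
    MeasureTheory.Integrable (fun k => (∑ i, omega m (k i)) * ‖η n k l‖ ^ 2)
      MeasureTheory.volume)

/-- Annihilation operator `a(h) = ∑_λ ∫ conj h(k, λ) a_λ(k) d³k`. -/
def annihilate (h : E3 → Fin 2 → ℂ) (η : Fock) : Fock := fun n k l =>
  (Real.sqrt (n + 1) : ℂ) *
    ∑ μ : Fin 2, ∫ q : E3, conj (h q μ) * η (n + 1) (Fin.cons q k) (Fin.cons μ l)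

/-- Creation operator `a*(h) = ∑_λ ∫ h(k, λ) a*_λ(k) d³k`. -/
def create (h : E3 → Fin 2 → ℂ) (η : Fock) : Fock
  | 0 => 0
  | n + 1 => fun k l =>
      (Real.sqrt (n + 1) : ℂ)⁻¹ *
        ∑ i : Fin (n + 1), h (k i) (l i) * η n (i.removeNth k) (i.removeNth l)

/-- First polarization vector `(k₂, -k₁, 0) / √(k₁² + k₂²)`. -/
def pol1 (k : E3) : Fin 3 → ℝ :=
  (Real.sqrt (k 0 ^ 2 + k 1 ^ 2))⁻¹ • ![k 1, -(k 0), 0]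

/-- Polarization vectors `ε₁(k)` and `ε₂(k) = (k / |k|) ∧ ε₁(k)`. -/
def pol (k : E3) (μ : Fin 2) : Fin 3 → ℝ :=
  if μ = 0 then pol1 k else crossProduct (fun a => k a / ‖k‖) (pol1 k)

/-- The common factor `1_{|k| < Λ} |k|^{-1/2} e^{-i k·x}` of the form factors of the fields. -/
def fieldFactor (Λ : ℝ) (x k : E3) : ℂ :=
  if ‖k‖ < Λ then ((Real.sqrt ‖k‖)⁻¹ : ℂ) * Complex.exp (-Complex.I * (inner ℝ k x : ℝ)) else 0

/-- Form factor of the component `A_a(x)` of the vector potential. -/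
def formA (Λ : ℝ) (x : E3) (a : Fin 3) (k : E3) (μ : Fin 2) : ℂ :=
  fieldFactor Λ x k * (pol k μ a : ℂ)

/-- Form factor of the component `B_a(x)` of the magnetic field `B = curl A`. -/
def formB (Λ : ℝ) (x : E3) (a : Fin 3) (k : E3) (μ : Fin 2) : ℂ :=
  -Complex.I * fieldFactor Λ x k * (crossProduct (fun b => k b) (pol k μ) a : ℝ)

/-- `A(x) = ∑_λ ∫_{|k|<Λ} |k|^{-1/2} [ε_λ(k) a_λ(k) e^{ik·x} + ε_λ(k) a*_λ(k) e^{-ik·x}] d³k`,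
component `a`. -/
def fieldA (Λ : ℝ) (x : E3) (a : Fin 3) (η : Fock) : Fock :=
  annihilate (formA Λ x a) η + create (formA Λ x a) η

/-- `B(x) = curl A(x)`, component `a`. -/
def fieldB (Λ : ℝ) (x : E3) (a : Fin 3) (η : Fock) : Fock :=
  annihilate (formB Λ x a) η + create (formB Λ x a) η

/-! ## The `N`-particle Hamiltonian -/

/-- (Representatives of) vectors of `⊗^N L²(ℝ³; ℂ²) ⊗ Fock`, as functions of `X` and `σ`. -/
abbrev State (N : ℕ) := Config N → Spins N → Fock

/-- The product of a function of `X`, a vector of the standard basis of the spin space and a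
vector of the Fock space. -/
def productState {N : ℕ} (f : Config N → ℂ) (s : Spins N) (η : Fock) : State N :=
  fun X σ => if σ = s then f X • η else 0

/-- The form core: finite linear combinations of products of `C_c^∞` functions of `X`, spin
vectors, and Fock space vectors with finitely many photons and finite field energy. -/
def core (N : ℕ) (m : ℝ) : Submodule ℂ (State N) :=
  Submodule.span ℂ {Ψ | ∃ (f : Config N → ℂ) (s : Spins N) (η : Fock),
    IsTest f ∧ IsFiniteFock m η ∧ Ψ = productState f s η}

/-- Pauli principle: antisymmetry under simultaneous permutations of positions and spins. -/
def IsAntisymm {N : ℕ} (Ψ : State N) : Prop :=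
  ∀ (π : Equiv.Perm (Fin N)) (X : Config N) (σ : Spins N),
    Ψ (X ∘ π) (σ ∘ π) = ((Equiv.Perm.sign π : ℤ) : ℂ) • Ψ X σ

/-- Squared norm of a state. -/
def normSq {N : ℕ} (Ψ : State N) : ℝ :=
  ∫ X : Config N, ∑ σ : Spins N, fockNormSq (Ψ X σ)

/-- Component `a` of `p_j Ψ = -i ∇_j Ψ`. -/
def momentum {N : ℕ} (j : Fin N) (a : Fin 3) (Ψ : State N) : State N := fun X σ n k l =>
  -Complex.I *
    lineDeriv ℝ (fun Y => Ψ Y σ n k l) X (Pi.single j (EuclideanSpace.single a 1))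

/-- Component `a` of `(p_j + √α A(x_j)) Ψ`. -/
def covMomentum {N : ℕ} (α Λ : ℝ) (j : Fin N) (a : Fin 3) (Ψ : State N) : State N :=
  fun X σ => momentum j a Ψ X σ + (Real.sqrt α : ℂ) • fieldA Λ (X j) a (Ψ X σ)

/-- The Pauli matrices. -/
def pauli : Fin 3 → Matrix (Fin 2) (Fin 2) ℂ :=
  ![!![0, 1; 1, 0], !![0, -Complex.I; Complex.I, 0], !![1, 0; 0, -1]]

/-- The Pauli matrix with index `a` acting on the spin of particle `j`. -/
def spinOp {N : ℕ} (j : Fin N) (a : Fin 3) (Ψ : State N) : State N := fun X σ =>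
  ∑ t : Fin 2, pauli a (σ j) t • Ψ X (Function.update σ j t)

/-- `(Ψ, (p_j + √α A(x_j))² Ψ) = ‖(p_j + √α A(x_j)) Ψ‖²`. -/
def kineticEnergy {N : ℕ} (α Λ : ℝ) (j : Fin N) (Ψ : State N) : ℝ :=
  ∑ a : Fin 3, normSq (covMomentum α Λ j a Ψ)

/-- `(Ψ, σ_j · B(x_j) Ψ)`. -/
def zeemanEnergy {N : ℕ} (Λ : ℝ) (j : Fin N) (Ψ : State N) : ℝ :=
  (∫ X : Config N, ∑ σ : Spins N, ∑ a : Fin 3,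
    fockInner (Ψ X σ) (fieldB Λ (X j) a (spinOp j a Ψ X σ))).re

/-- The external potential `V(X) = ∑_j v(x_j)`. -/
def externalPotential (N : ℕ) (v : E3 → ℝ) (X : Config N) : ℝ := ∑ j, v (X j)

/-- `(Ψ, W(X) Ψ)` for a multiplication operator `W`. -/
def potentialEnergy {N : ℕ} (W : Config N → ℝ) (Ψ : State N) : ℝ :=
  ∫ X : Config N, W X * ∑ σ : Spins N, fockNormSq (Ψ X σ)

/-- The quadratic form `(Ψ, H^V Ψ)` of the Hamiltonian
`H^V = ∑_j {(p_j + √α A(x_j))² + (g/2) √α σ_j · B(x_j)} + V(X) + I(X) + H_f`. -/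
def energy {N : ℕ} (α g Λ m : ℝ) (v : E3 → ℝ) (I : Config N → ℝ) (Ψ : State N) : ℝ :=
  (∑ j : Fin N, (kineticEnergy α Λ j Ψ + g / 2 * Real.sqrt α * zeemanEnergy Λ j Ψ))
    + potentialEnergy (externalPotential N v) Ψ
    + potentialEnergy I Ψ
    + ∫ X : Config N, ∑ σ : Spins N, fieldEnergy m (Ψ X σ)

/-- `E^V(N)`: the infimum of `(Ψ, H^V Ψ)` over the normalized antisymmetric vectors of the form
core, that is, the bottom of the spectrum of the Friedrichs extension of `H^V` (and `-∞` if the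
form is unbounded below). `E^0(N)` is the case `v = 0`. -/
def groundEnergy (N : ℕ) (α g Λ m : ℝ) (v : E3 → ℝ) (I : Config N → ℝ) : EReal :=
  ⨅ Ψ ∈ {Ψ : State N | Ψ ∈ core N m ∧ IsAntisymm Ψ ∧ normSq Ψ = 1},
    ((energy α g Λ m v I Ψ : ℝ) : EReal)

/-- Interparticle interactions: locally integrable, invariant under common translations of
all particles, and symmetric in the particle labels. -/
structure IsInteraction {N : ℕ} (I : Config N → ℝ) : Prop where
  locallyIntegrable : MeasureTheory.LocallyIntegrable I MeasureTheory.volume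
  translation : ∀ y : E3, ∀ᵐ X : Config N, I (fun j => X j + y) = I X
  symmetric : ∀ π : Equiv.Perm (Fin N), ∀ᵐ X : Config N, I (X ∘ π) = I X

end

end QED

/-! # Binding of at least one particle in non-relativistic QED

The proof is the localization argument with an average over translations. Given a normalized
antisymmetric vector `Ψ` of the form core with energy `E` at `v = 0`, translate the particles
together with the radiation field by `y ∈ ℝ³`; this changes neither the norm nor the energy without
external potential (`energyDensity_translate`). Multiply the result by a symmetric real
function `G` of the particle positions. By the Leibniz rule for the covariant momentum, the energy density of the
product (`energyDensity_localize`) is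

`G² · (energy density of Ψ) + |∇G|² ‖Ψ‖² + G ∇G · (current of Ψ) + V G² ‖Ψ‖²`.

If `G² = ∑_j ρ(x_j)` for a one-body density `ρ`, then `G ∇_j G` is half of `∇ρ(x_j)`, whose average
over all translations vanishes, so that no integration by parts in the particle variables and no
bound on the current beyond its integrability is needed. The integral over `y` of the energies
of the trial states is then at most `N (E ∫ρ + ∫κ + ∫w)`, where `κ` and `w` bound the kinetic and
potential energy of `G`, and that of their squared norms is `N ∫ρ`; this gives
`IsLocalizer.groundEnergy_le`.

It remains to choose `G`. A bound state of `p² + v` provides real test functions `ψ` with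
`∫ |∇ψ|² + v ψ² ≤ (-e₀ + ε) ∫ ψ²` (`IsBoundState.exists_real`). For one particle take
`G = ψ(x₁)` (`isLocalizer_one`). For `v ≤ 0` and any `N` take
`G = (∑_j (ψ(x_j)² + d η(x_j)²))^{1/2}` with a positive function `η` that keeps the root smooth, and
let `d → 0` (`isLocalizer_sqrt`); here `v ≤ 0` is used to discard from
`∑_j v(x_j) G²` all terms other than `v(x_j) ψ(x_j)²`.

All densities have to be integrable for these computations to be meaningful. This follows from
joint square integrability in particle positions and photon momenta (`IsRegular`), which creation
and annihilation operators with form factors bounded by a square integrable function preserve. -/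

namespace QED
open MeasureTheory Filter Topology
noncomputable section

/-! ### Inner products in the Fock space -/

/-- Fock vectors with finitely many photons and square integrable amplitudes. -/
def IsL2Fock (η : Fock) : Prop :=
  (∃ M : ℕ, ∀ n ≥ M, η n = 0) ∧
    ∀ (n : ℕ) (l : Fin n → Fin 2), MemLp (fun k => η n k l) 2 volume

lemma IsL2Fock.add {η ζ : Fock} (hη : IsL2Fock η) (hζ : IsL2Fock ζ) : IsL2Fock (η + ζ) := by
  obtain ⟨⟨M, hM⟩, h⟩ := hη
  obtain ⟨⟨M', hM'⟩, h'⟩ := hζ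
  refine ⟨⟨max M M', fun n hn => ?_⟩, fun n l => (h n l).add (h' n l)⟩
  simp [hM n (le_trans (le_max_left _ _) hn), hM' n (le_trans (le_max_right _ _) hn)]

lemma IsL2Fock.smul {η : Fock} (c : ℂ) (hη : IsL2Fock η) : IsL2Fock (c • η) := by
  obtain ⟨⟨M, hM⟩, h⟩ := hη
  exact ⟨⟨M, fun n hn => by simp [hM n hn]⟩, fun n l => (h n l).const_smul c⟩

lemma fockInner_eq_sum (η ζ : Fock) (M : ℕ) (hM : ∀ n ≥ M, η n = 0) :
    fockInner η ζ = ∑ n ∈ Finset.range M, ∑ l : Fin n → Fin 2,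
      ∫ k : Fin n → E3, conj (η n k l) * ζ n k l := by
  refine tsum_eq_sum fun n hn => ?_
  simp [hM n (by simpa using hn)]

lemma fockNormSq_eq_sum (η : Fock) (M : ℕ) (hM : ∀ n ≥ M, η n = 0) :
    fockNormSq η = ∑ n ∈ Finset.range M, ∑ l : Fin n → Fin 2,
      ∫ k : Fin n → E3, ‖η n k l‖ ^ 2 := by
  refine tsum_eq_sum fun n hn => ?_
  simp [hM n (by simpa using hn)]

lemma fockInner_self (η : Fock) : fockInner η η = (fockNormSq η : ℂ) := by
  simp only [fockInner, fockNormSq, Complex.ofReal_tsum, Complex.ofReal_sum]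
  refine tsum_congr fun n => Finset.sum_congr rfl fun l _ => ?_
  rw [← integral_complex_ofReal]
  congr 1 with k
  rw [Complex.conj_mul', Complex.ofReal_pow]

lemma fockNormSq_nonneg (η : Fock) : 0 ≤ fockNormSq η :=
  tsum_nonneg fun _ => Finset.sum_nonneg fun _ _ => integral_nonneg fun _ => by positivity

lemma fockInner_smul_smul (c d : ℂ) (η ζ : Fock) :
    fockInner (c • η) (d • ζ) = conj c * d * fockInner η ζ := by
  simp only [fockInner, ← tsum_mul_left, Finset.mul_sum, ← integral_const_mul]
  refine tsum_congr fun n => Finset.sum_congr rfl fun l _ => ?_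
  congr 1 with k
  simp only [Pi.smul_apply, smul_eq_mul, map_mul]
  ring

lemma fockNormSq_smul (c : ℂ) (η : Fock) : fockNormSq (c • η) = ‖c‖ ^ 2 * fockNormSq η := by
  simp only [fockNormSq, ← tsum_mul_left, Finset.mul_sum, ← integral_const_mul]
  refine tsum_congr fun n => Finset.sum_congr rfl fun l _ => ?_
  congr 1 with k
  simp only [Pi.smul_apply, smul_eq_mul, norm_mul]
  ring

lemma integrable_conj_mul {Y : Type*} [MeasurableSpace Y] {μ : Measure Y} {f g : Y → ℂ}
    (hf : MemLp f 2 μ) (hg : MemLp g 2 μ) : Integrable (fun y => conj (f y) * g y) μ :=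
  MemLp.integrable_mul (hf.star) hg

lemma fockNormSq_add {η ζ : Fock} (hη : IsL2Fock η) (hζ : IsL2Fock ζ) :
    fockNormSq (η + ζ) = fockNormSq η + fockNormSq ζ + 2 * (fockInner η ζ).re := by
  obtain ⟨⟨M, hM⟩, h⟩ := hη
  obtain ⟨⟨M', hM'⟩, h'⟩ := hζ
  have hl : ∀ n ≥ max M M', η n = 0 := fun n hn => hM n (le_trans (le_max_left _ _) hn)
  have hr : ∀ n ≥ max M M', ζ n = 0 := fun n hn => hM' n (le_trans (le_max_right _ _) hn)
  rw [fockNormSq_eq_sum _ _ hl, fockNormSq_eq_sum _ _ hr, fockInner_eq_sum _ _ _ hl,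
    fockNormSq_eq_sum (η + ζ) (max M M') (fun n hn => by simp [hl n hn, hr n hn])]
  simp only [Complex.re_sum, Finset.mul_sum, ← Finset.sum_add_distrib]
  refine Finset.sum_congr rfl fun n _ => Finset.sum_congr rfl fun l _ => ?_
  have hi := integrable_conj_mul (h n l) (h' n l)
  have hre : (∫ k, conj (η n k l) * ζ n k l).re = ∫ k, (conj (η n k l) * ζ n k l).re :=
    (integral_re hi).symm
  have hn1 : Integrable (fun k => ‖η n k l‖ ^ 2) := (h n l).integrable_norm_pow two_ne_zero
  have hn2 : Integrable (fun k => ‖ζ n k l‖ ^ 2) := (h' n l).integrable_norm_pow two_ne_zero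
  rw [hre, ← integral_const_mul, ← integral_add hn1 hn2]
  have hn : Integrable (fun k => ‖η n k l‖ ^ 2 + ‖ζ n k l‖ ^ 2) := hn1.add hn2
  have hi2 : Integrable (fun k => 2 * (conj (η n k l) * ζ n k l).re) := hi.re.const_mul 2
  rw [← integral_add hn hi2]
  congr 1 with k
  simp only [Pi.add_apply, ← Complex.normSq_eq_norm_sq, Complex.normSq_add, Complex.mul_re,
    Complex.conj_re, Complex.conj_im]
  ring

/-- The expansion of the square behind the localization formula. -/
lemma fockNormSq_smul_add_smul {η ζ : Fock} (hη : IsL2Fock η) (hζ : IsL2Fock ζ) (x y : ℝ) :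
    fockNormSq ((x : ℂ) • η + (-Complex.I * y) • ζ)
      = x ^ 2 * fockNormSq η + y ^ 2 * fockNormSq ζ
        + x * y * (2 * (fockInner η (-Complex.I • ζ)).re) := by
  rw [fockNormSq_add (hη.smul _) (hζ.smul _), fockNormSq_smul, fockNormSq_smul,
    show (-Complex.I * (y : ℂ)) • ζ = (y : ℂ) • (-Complex.I • ζ) by rw [smul_smul, mul_comm],
    fockInner_smul_smul]
  have : conj (x : ℂ) * (y : ℂ) = ((x * y : ℝ) : ℂ) := by simp
  rw [this, Complex.re_ofReal_mul]
  simp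
  ring

/-- If `η` has norm zero, it is orthogonal to every vector. -/
lemma fockInner_eq_zero {η : Fock} (hη : IsL2Fock η) (h0 : fockNormSq η = 0) (ζ : Fock) :
    fockInner η ζ = 0 := by
  obtain ⟨⟨M, hM⟩, h⟩ := hη
  rw [fockInner_eq_sum _ _ _ hM]
  rw [fockNormSq_eq_sum _ _ hM] at h0
  refine Finset.sum_eq_zero fun n hn => Finset.sum_eq_zero fun l _ => ?_
  have h1 := (Finset.sum_eq_zero_iff_of_nonneg (fun n _ => Finset.sum_nonneg fun l _ =>
    integral_nonneg fun k => by positivity)).1 h0 n hn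
  have h2 := (Finset.sum_eq_zero_iff_of_nonneg (fun l _ =>
    integral_nonneg fun k => by positivity)).1 h1 l (Finset.mem_univ l)
  rw [integral_eq_zero_iff_of_nonneg (fun k => by positivity)
    ((h n l).integrable_norm_pow two_ne_zero)] at h2
  refine integral_eq_zero_of_ae ?_
  filter_upwards [h2] with k hk
  have : η n k l = 0 := by simpa using hk
  simp [this]

/-! ### States that are jointly square integrable in particle and photon variables -/

/-- States with a bounded number of photons whose amplitudes are square integrable jointly in the
particle positions and the photon momenta. -/
def IsRegular {N : ℕ} (Φ : State N) : Prop :=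
  (∃ M : ℕ, ∀ n ≥ M, ∀ X σ, Φ X σ n = 0) ∧
    ∀ (n : ℕ) (σ : Spins N) (l : Fin n → Fin 2),
      MemLp (fun p : Config N × (Fin n → E3) => Φ p.1 σ n p.2 l) 2 (volume.prod volume)

variable {N : ℕ}

lemma IsRegular.zero : IsRegular (0 : State N) :=
  ⟨⟨0, fun _ _ _ _ => rfl⟩, fun _ _ _ => MemLp.zero'⟩

lemma IsRegular.add {Φ Ψ : State N} (hΦ : IsRegular Φ) (hΨ : IsRegular Ψ) :
    IsRegular (Φ + Ψ) := by
  obtain ⟨⟨M, hM⟩, h⟩ := hΦ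
  obtain ⟨⟨M', hM'⟩, h'⟩ := hΨ
  refine ⟨⟨max M M', fun n hn X σ => ?_⟩, fun n σ l => (h n σ l).add (h' n σ l)⟩
  simp [hM n (le_trans (le_max_left _ _) hn), hM' n (le_trans (le_max_right _ _) hn)]

lemma IsRegular.smul {Φ : State N} (c : ℂ) (hΦ : IsRegular Φ) : IsRegular (c • Φ) := by
  obtain ⟨⟨M, hM⟩, h⟩ := hΦ
  exact ⟨⟨M, fun n hn X σ => by simp [hM n hn]⟩, fun n σ l => (h n σ l).const_smul c⟩

lemma IsRegular.ae_isL2Fock {Φ : State N} (hΦ : IsRegular Φ) :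
    ∀ᵐ X, ∀ σ, IsL2Fock (Φ X σ) := by
  obtain ⟨⟨M, hM⟩, h⟩ := hΦ
  have key : ∀ᵐ X, ∀ σ n l, MemLp (fun k => Φ X σ n k l) 2 volume := by
    simp only [ae_all_iff]
    intro σ n l
    have h1 := ((h n σ l).integrable_norm_pow two_ne_zero).prod_right_ae
    have h2 := (h n σ l).aestronglyMeasurable.prodMk_left
    filter_upwards [h1, h2] with X hX1 hX2
    exact (memLp_two_iff_integrable_sq_norm hX2).2 hX1
  filter_upwards [key] with X hX σ
  exact ⟨⟨M, fun n hn => hM n hn X σ⟩, fun n l => hX σ n l⟩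

lemma IsRegular.integrable_fockInner {Φ Ψ : State N} (hΦ : IsRegular Φ) (hΨ : IsRegular Ψ)
    (σ : Spins N) : Integrable (fun X => fockInner (Φ X σ) (Ψ X σ)) := by
  obtain ⟨⟨M, hM⟩, h⟩ := hΦ
  have : (fun X => fockInner (Φ X σ) (Ψ X σ)) = fun X => ∑ n ∈ Finset.range M,
      ∑ l : Fin n → Fin 2, ∫ k : Fin n → E3, conj (Φ X σ n k l) * Ψ X σ n k l :=
    funext fun X => fockInner_eq_sum _ _ M fun n hn => hM n hn X σ
  rw [this]
  refine integrable_finsetSum _ fun n _ => integrable_finsetSum _ fun l _ => ?_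
  exact (integrable_conj_mul (h n σ l) (hΨ.2 n σ l)).integral_prod_left

lemma IsRegular.integrable_fockNormSq {Φ : State N} (hΦ : IsRegular Φ) (σ : Spins N) :
    Integrable (fun X => fockNormSq (Φ X σ)) := by
  have := (hΦ.integrable_fockInner hΦ σ).re
  simpa only [fockInner_self, RCLike.re_to_complex, Complex.ofReal_re] using this

/-! ### Creation and annihilation operators preserve joint square integrability -/

/-- A position dependent family of one-photon functions with a square integrable bound `b` that is
uniform in the position. -/
structure IsFormFactor {N : ℕ} (h : Config N → E3 → Fin 2 → ℂ) (b : E3 → ℝ) : Prop where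
  measurable : ∀ μ, Measurable fun p : Config N × E3 => h p.1 p.2 μ
  bound : ∀ X q μ, ‖h X q μ‖ ≤ b q
  memLp : MemLp b 2 volume

lemma measurePreserving_splitPhoton {n : ℕ} (i : Fin (n + 1)) :
    MeasurePreserving (fun p : Config N × (Fin (n + 1) → E3) => (p.2 i, (p.1, i.removeNth p.2)))
      (volume.prod volume) (volume.prod (volume.prod volume)) := by
  have h1 := (MeasurePreserving.id (volume : Measure (Config N))).prod
    (volume_preserving_piFinSuccAbove (fun _ : Fin (n + 1) => E3) i)
  have h2 : MeasurePreserving (Prod.map Prod.swap id)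
      (((volume : Measure (Config N)).prod (volume : Measure E3)).prod
        (volume : Measure (Fin n → E3))) ((volume.prod volume).prod volume) :=
    Measure.measurePreserving_swap.prod (MeasurePreserving.id _)
  have h3 := measurePreserving_prodAssoc (volume : Measure E3) (volume : Measure (Config N))
    (volume : Measure (Fin n → E3))
  have h4 := (measurePreserving_prodAssoc (volume : Measure (Config N)) (volume : Measure E3)
    (volume : Measure (Fin n → E3))).symm MeasurableEquiv.prodAssoc
  exact h3.comp (h2.comp (h4.comp h1))

lemma measurePreserving_consPhoton {n : ℕ} :
    MeasurePreserving (fun r : E3 × (Config N × (Fin n → E3)) =>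
        (r.2.1, (Fin.cons r.1 r.2.2 : Fin (n + 1) → E3)))
      (volume.prod (volume.prod volume)) (volume.prod volume) := by
  have h1 := (MeasurePreserving.id (volume : Measure (Config N))).prod
    ((volume_preserving_piFinSuccAbove (fun _ : Fin (n + 1) => E3) 0).symm
      (MeasurableEquiv.piFinSuccAbove (fun _ : Fin (n + 1) => E3) 0))
  have h2 : MeasurePreserving (Prod.map Prod.swap id)
      (((volume : Measure E3).prod (volume : Measure (Config N))).prod
        (volume : Measure (Fin n → E3))) ((volume.prod volume).prod volume) :=
    Measure.measurePreserving_swap.prod (MeasurePreserving.id _)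
  have h3 := (measurePreserving_prodAssoc (volume : Measure E3) (volume : Measure (Config N))
    (volume : Measure (Fin n → E3))).symm MeasurableEquiv.prodAssoc
  have h4 := measurePreserving_prodAssoc (volume : Measure (Config N)) (volume : Measure E3)
    (volume : Measure (Fin n → E3))
  have := h1.comp (h4.comp (h2.comp h3))
  convert this using 2 with r
  simp [MeasurableEquiv.piFinSuccAbove, MeasurableEquiv.prodAssoc, Fin.insertNthEquiv]

lemma memLp_mul_prod {Y Z : Type*} [MeasurableSpace Y] [MeasurableSpace Z] {μ : Measure Y}
    {ν : Measure Z} [SFinite μ] [SFinite ν] {𝕜 : Type*} [RCLike 𝕜] {f : Y → 𝕜} {g : Z → 𝕜}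
    (hf : MemLp f 2 μ) (hg : MemLp g 2 ν) :
    MemLp (fun z : Y × Z => f z.1 * g z.2) 2 (μ.prod ν) := by
  have hm : AEStronglyMeasurable (fun z : Y × Z => f z.1 * g z.2) (μ.prod ν) :=
    (hf.1.comp_fst).mul (hg.1.comp_snd)
  rw [memLp_two_iff_integrable_sq_norm hm]
  refine ((hf.integrable_norm_pow two_ne_zero).mul_prod
    (hg.integrable_norm_pow two_ne_zero)).congr (ae_of_all _ fun z => ?_)
  simp only [norm_mul, mul_pow]

/-- The Cauchy–Schwarz inequality. -/
lemma norm_integral_conj_mul_sq_le {Y : Type*} [MeasurableSpace Y] {μ : Measure Y} {f g : Y → ℂ}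
    (hf : MemLp f 2 μ) (hg : MemLp g 2 μ) :
    ‖∫ y, conj (f y) * g y ∂μ‖ ^ 2 ≤ (∫ y, ‖f y‖ ^ 2 ∂μ) * ∫ y, ‖g y‖ ^ 2 ∂μ := by
  have h1 : ‖∫ y, conj (f y) * g y ∂μ‖ ≤ ∫ y, ‖f y‖ * ‖g y‖ ∂μ := by
    refine (norm_integral_le_integral_norm _).trans_eq ?_
    simp
  have h2 := integral_mul_le_Lp_mul_Lq_of_nonneg (μ := μ) (p := 2) (q := 2)
    Real.HolderConjugate.two_two (f := fun y => ‖f y‖) (g := fun y => ‖g y‖)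
    (ae_of_all _ fun _ => norm_nonneg _) (ae_of_all _ fun _ => norm_nonneg _)
    (by simpa using hf.norm) (by simpa using hg.norm)
  simp only [Real.rpow_two, ← Real.sqrt_eq_rpow] at h2
  have hf0 : 0 ≤ ∫ y, ‖f y‖ ^ 2 ∂μ := integral_nonneg fun _ => by positivity
  have hg0 : 0 ≤ ∫ y, ‖g y‖ ^ 2 ∂μ := integral_nonneg fun _ => by positivity
  calc _ ≤ (√(∫ y, ‖f y‖ ^ 2 ∂μ) * √(∫ y, ‖g y‖ ^ 2 ∂μ)) ^ 2 := by
        gcongr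
        exact h1.trans h2
    _ = _ := by rw [mul_pow, Real.sq_sqrt hf0, Real.sq_sqrt hg0]

lemma IsRegular.create {Φ : State N} (hΦ : IsRegular Φ) {h : Config N → E3 → Fin 2 → ℂ}
    {b : E3 → ℝ} (hh : IsFormFactor h b) :
    IsRegular (fun X σ => create (h X) (Φ X σ)) := by
  obtain ⟨⟨M, hM⟩, hL⟩ := hΦ
  refine ⟨⟨M + 1, fun n hn X σ => ?_⟩, fun n σ l => ?_⟩
  · obtain ⟨n, rfl⟩ : ∃ n', n = n' + 1 := ⟨n - 1, by omega⟩
    funext k l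
    simp [QED.create, hM n (by omega) X σ]
  · cases n with
    | zero => exact MemLp.zero'
    | succ n =>
      suffices hs : ∀ i : Fin (n + 1), MemLp (fun p : Config N × (Fin (n + 1) → E3) =>
          h p.1 (p.2 i) (l i) * Φ p.1 σ n (i.removeNth p.2) (i.removeNth l)) 2
          (volume.prod volume) by
        have hsum := memLp_finsetSum Finset.univ fun i _ => hs i
        exact hsum.const_mul ((√((n : ℝ) + 1) : ℂ)⁻¹)
      intro i
      have hT := (memLp_mul_prod (hh.memLp) (hL n σ (i.removeNth l)).norm).comp_measurePreserving
        (measurePreserving_splitPhoton (N := N) i)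
      have hmeas : AEStronglyMeasurable (fun p : Config N × (Fin (n + 1) → E3) =>
          Φ p.1 σ n (i.removeNth p.2) (i.removeNth l)) (volume.prod volume) :=
        ((hL n σ (i.removeNth l)).1.comp_snd (μ := (volume : Measure E3))).comp_measurePreserving
          (measurePreserving_splitPhoton (N := N) i)
      have hmeas' : Measurable (fun p : Config N × (Fin (n + 1) → E3) =>
          h p.1 (p.2 i) (l i)) := (hh.measurable (l i)).comp
        (show Measurable fun p : Config N × (Fin (n + 1) → E3) => (p.1, p.2 i) by fun_prop)
      refine hT.mono (hmeas'.aestronglyMeasurable.mul hmeas) (ae_of_all _ fun p => ?_)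
      simp only [Function.comp_apply, norm_mul, norm_norm]
      gcongr
      exact (hh.bound _ _ _).trans (le_abs_self _)

lemma IsRegular.annihilate {Φ : State N} (hΦ : IsRegular Φ) {h : Config N → E3 → Fin 2 → ℂ}
    {b : E3 → ℝ} (hh : IsFormFactor h b) :
    IsRegular (fun X σ => annihilate (h X) (Φ X σ)) := by
  obtain ⟨⟨M, hM⟩, hL⟩ := hΦ
  refine ⟨⟨M, fun n hn X σ => ?_⟩, fun n σ l => ?_⟩
  · funext k l
    simp [QED.annihilate, hM (n + 1) (by omega) X σ]
  · suffices hs : ∀ μ : Fin 2, MemLp (fun p : Config N × (Fin n → E3) =>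
        ∫ q : E3, conj (h p.1 q μ) * Φ p.1 σ (n + 1) (Fin.cons q p.2) (Fin.cons μ l)) 2
        (volume.prod volume) by
      have hsum := memLp_finsetSum Finset.univ fun μ _ => hs μ
      exact hsum.const_mul (√((n : ℝ) + 1) : ℂ)
    intro μ
    set l' : Fin (n + 1) → Fin 2 := Fin.cons μ l
    have hT : MemLp (fun r : E3 × (Config N × (Fin n → E3)) =>
        Φ r.2.1 σ (n + 1) (Fin.cons r.1 r.2.2) l') 2 (volume.prod (volume.prod volume)) :=
      (hL (n + 1) σ l').comp_measurePreserving measurePreserving_consPhoton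
    have hmeas : Measurable (fun r : E3 × (Config N × (Fin n → E3)) => conj (h r.2.1 r.1 μ)) :=
      Complex.continuous_conj.measurable.comp ((hh.measurable μ).comp
        (show Measurable fun r : E3 × (Config N × (Fin n → E3)) => (r.2.1, r.1) by fun_prop))
    have hF : AEStronglyMeasurable (fun p : Config N × (Fin n → E3) =>
        ∫ q : E3, conj (h p.1 q μ) * Φ p.1 σ (n + 1) (Fin.cons q p.2) l')
        (volume.prod volume) :=
      ((hmeas.aestronglyMeasurable.mul hT.1).prod_swap).integral_prod_right'
    rw [memLp_two_iff_integrable_sq_norm hF]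
    have hsq := hT.integrable_norm_pow two_ne_zero
    refine (hsq.integral_prod_right.const_mul (∫ q, ‖b q‖ ^ 2)).mono' (hF.norm.pow 2) ?_
    filter_upwards [hsq.prod_left_ae, hT.1.prod_swap.prodMk_left] with p hp1 hp2
    have hg : MemLp (fun q => Φ p.1 σ (n + 1) (Fin.cons q p.2) l') 2 volume :=
      (memLp_two_iff_integrable_sq_norm hp2).2 hp1
    have hf : MemLp (fun q => h p.1 q μ) 2 volume :=
      hh.memLp.mono ((hh.measurable μ).comp measurable_prodMk_left).aestronglyMeasurable
        (ae_of_all _ fun q => (hh.bound _ _ _).trans (le_abs_self _))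
    rw [Real.norm_of_nonneg (by positivity)]
    refine (norm_integral_conj_mul_sq_le hf hg).trans ?_
    refine mul_le_mul_of_nonneg_right ?_ (integral_nonneg fun _ => by positivity)
    refine integral_mono (hf.integrable_norm_pow two_ne_zero)
      (hh.memLp.integrable_norm_pow two_ne_zero) fun q => ?_
    have := (hh.bound p.1 q μ).trans (le_abs_self _)
    simp only [Real.norm_eq_abs]
    gcongr

/-! ### The form factors of the quantized fields -/

/-- A bound for all components of the form factors of `A` and `B`. -/
def formBound (Λ : ℝ) (q : E3) : ℝ :=
  if ‖q‖ < Λ then (4 * (1 + Λ)) * (√‖q‖)⁻¹ else 0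

lemma memLp_formBound {Λ : ℝ} (hΛ : 0 < Λ) : MemLp (formBound Λ) 2 volume := by
  have hm : Measurable (formBound Λ) :=
    Measurable.ite (measurableSet_lt measurable_norm measurable_const)
      (by fun_prop) measurable_const
  rw [memLp_two_iff_integrable_sq hm.aestronglyMeasurable]
  have := (integrable_fun_norm_addHaar (volume : Measure E3)
    (f := fun r => (if r < Λ then (4 * (1 + Λ)) * (√r)⁻¹ else 0) ^ 2)).2 ?_
  · exact this
  · have h2 : IntegrableOn (fun _ : ℝ => (4 * (1 + Λ)) ^ 2 * Λ) (Set.Ioc 0 Λ) :=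
      integrableOn_const (by simp)
    have h3 : IntegrableOn (Set.indicator (Set.Ioc 0 Λ) fun _ : ℝ => (4 * (1 + Λ)) ^ 2 * Λ)
      (Set.Ioi 0) := ((integrable_indicator_iff measurableSet_Ioc).2 h2).integrableOn
    refine h3.mono' (Measurable.aestronglyMeasurable ?_) ?_
    · have hm1 : Measurable fun r : ℝ => if r < Λ then (4 * (1 + Λ)) * (√r)⁻¹ else 0 :=
        Measurable.ite measurableSet_Iio (by fun_prop) measurable_const
      exact (measurable_id.pow_const _).smul (hm1.pow_const _)
    · refine (ae_restrict_iff' measurableSet_Ioi).2 (ae_of_all _ fun r hr => ?_)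
      have hr0 : 0 < r := hr
      have hfr : Module.finrank ℝ E3 - 1 = 2 := by simp
      rw [hfr, Real.norm_of_nonneg (by positivity)]
      by_cases h : r < Λ
      · rw [if_pos h, Set.indicator_of_mem (Set.mem_Ioc.2 ⟨hr0, h.le⟩), mul_pow, inv_pow,
          Real.sq_sqrt hr0.le, smul_eq_mul]
        have : r ^ 2 * ((4 * (1 + Λ)) ^ 2 * r⁻¹) = (4 * (1 + Λ)) ^ 2 * r := by
          field_simp
        rw [this]
        gcongr
      · rw [if_neg h]
        simp only [ne_eq, OfNat.ofNat_ne_zero, not_false_eq_true, zero_pow, smul_zero]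
        exact Set.indicator_nonneg (fun _ _ => by positivity) _

lemma abs_pol1_le (k : E3) (a : Fin 3) : |pol1 k a| ≤ 1 := by
  have h0 : |k 0| ≤ √(k 0 ^ 2 + k 1 ^ 2) :=
    Real.abs_le_sqrt (by nlinarith [sq_nonneg (k 1)])
  have h1 : |k 1| ≤ √(k 0 ^ 2 + k 1 ^ 2) :=
    Real.abs_le_sqrt (by nlinarith [sq_nonneg (k 0)])
  have hs := Real.sqrt_nonneg (k 0 ^ 2 + k 1 ^ 2)
  fin_cases a
  · simp only [pol1, Pi.smul_apply, smul_eq_mul, abs_mul, abs_inv, abs_of_nonneg hs]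
    simpa [inv_mul_eq_div] using div_le_one_of_le₀ h1 hs
  · simp only [pol1, Pi.smul_apply, smul_eq_mul, abs_mul, abs_inv, abs_of_nonneg hs]
    simpa [inv_mul_eq_div] using div_le_one_of_le₀ h0 hs
  · simp [pol1]

lemma abs_cross_le {u w : Fin 3 → ℝ} {r s : ℝ} (hu : ∀ a, |u a| ≤ r) (hw : ∀ a, |w a| ≤ s)
    (a : Fin 3) : |crossProduct u w a| ≤ 2 * (r * s) := by
  have key : ∀ i j i' j' : Fin 3, |u i * w j - u i' * w j'| ≤ 2 * (r * s) := by
    intro i j i' j'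
    have hr : 0 ≤ r := (abs_nonneg _).trans (hu 0)
    calc |u i * w j - u i' * w j'| ≤ |u i * w j| + |u i' * w j'| := abs_sub _ _
      _ = |u i| * |w j| + |u i'| * |w j'| := by rw [abs_mul, abs_mul]
      _ ≤ r * s + r * s := by gcongr <;> first | exact hu _ | exact hw _
      _ = _ := by ring
  rw [cross_apply]
  fin_cases a <;> exact key _ _ _ _

lemma abs_coord_le (k : E3) (a : Fin 3) : |k a| ≤ ‖k‖ := by
  simpa using PiLp.norm_apply_le k a

lemma abs_pol_le (k : E3) (μ : Fin 2) (a : Fin 3) : |pol k μ a| ≤ 2 := by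
  unfold pol
  split_ifs
  · linarith [abs_pol1_le k a]
  · refine (abs_cross_le (r := 1) (s := 1) (fun b => ?_) (abs_pol1_le k) a).trans (by norm_num)
    rw [abs_div, abs_norm]
    exact div_le_one_of_le₀ (abs_coord_le k b) (norm_nonneg _)

lemma norm_fieldFactor (Λ : ℝ) (x k : E3) :
    ‖fieldFactor Λ x k‖ = if ‖k‖ < Λ then (√‖k‖)⁻¹ else 0 := by
  unfold fieldFactor
  split_ifs
  · rw [norm_mul, show -Complex.I * ((inner ℝ k x : ℝ) : ℂ)
      = ((-(inner ℝ k x) : ℝ) : ℂ) * Complex.I by push_cast; ring, Complex.norm_exp_ofReal_mul_I]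
    simp [abs_of_nonneg (Real.sqrt_nonneg _)]
  · simp

lemma measurable_fieldFactor (Λ : ℝ) (j : Fin N) :
    Measurable fun p : Config N × E3 => fieldFactor Λ (p.1 j) p.2 := by
  unfold fieldFactor
  refine Measurable.ite (measurableSet_lt (by fun_prop) measurable_const) ?_ measurable_const
  fun_prop

lemma measurable_pol1 (a : Fin 3) : Measurable fun k : E3 => pol1 k a := by
  unfold pol1
  fin_cases a <;> simp <;> fun_prop

lemma measurable_cross {u w : E3 → Fin 3 → ℝ} (hu : ∀ a, Measurable fun k => u k a)
    (hw : ∀ a, Measurable fun k => w k a) (a : Fin 3) :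
    Measurable fun k => crossProduct (u k) (w k) a := by
  simp only [cross_apply]
  have key : ∀ i j i' j' : Fin 3, Measurable fun k => u k i * w k j - u k i' * w k j' :=
    fun i j i' j' => ((hu i).mul (hw j)).sub ((hu i').mul (hw j'))
  fin_cases a <;> exact key _ _ _ _

lemma measurable_pol (μ : Fin 2) (a : Fin 3) : Measurable fun k : E3 => pol k μ a := by
  unfold pol
  split_ifs
  · exact measurable_pol1 a
  · exact measurable_cross (fun b => by fun_prop) measurable_pol1 a

lemma isFormFactor_formA {Λ : ℝ} (hΛ : 0 < Λ) (j : Fin N) (a : Fin 3) :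
    IsFormFactor (fun X : Config N => formA Λ (X j) a) (formBound Λ) where
  measurable μ := (measurable_fieldFactor Λ j).mul
    (Complex.measurable_ofReal.comp ((measurable_pol μ a).comp measurable_snd))
  bound X q μ := by
    rw [formA, norm_mul, norm_fieldFactor, Complex.norm_real, Real.norm_eq_abs, formBound]
    have := abs_pol_le q μ a
    split_ifs
    · rw [mul_comm]
      gcongr
      linarith
    · simp
  memLp := memLp_formBound hΛ

lemma isFormFactor_formB {Λ : ℝ} (hΛ : 0 < Λ) (j : Fin N) (a : Fin 3) :
    IsFormFactor (fun X : Config N => formB Λ (X j) a) (formBound Λ) where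
  measurable μ := ((measurable_fieldFactor Λ j).const_mul _).mul
    (Complex.measurable_ofReal.comp ((measurable_cross (fun b => by fun_prop)
      (fun b => measurable_pol μ b) a).comp measurable_snd))
  bound X q μ := by
    rw [formB, norm_mul, norm_mul, norm_fieldFactor, Complex.norm_real, Real.norm_eq_abs,
      formBound]
    have := abs_cross_le (abs_coord_le q) (abs_pol_le q μ) a
    split_ifs with h
    · rw [mul_comm]
      simp only [norm_neg, Complex.norm_I, one_mul]
      gcongr
      linarith
    · simp
  memLp := memLp_formBound hΛ

lemma IsRegular.fieldA {Φ : State N} (hΦ : IsRegular Φ) {Λ : ℝ} (hΛ : 0 < Λ) (j : Fin N)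
    (a : Fin 3) : IsRegular (fun X σ => fieldA Λ (X j) a (Φ X σ)) :=
  (hΦ.annihilate (isFormFactor_formA hΛ j a)).add (hΦ.create (isFormFactor_formA hΛ j a))

lemma IsRegular.fieldB {Φ : State N} (hΦ : IsRegular Φ) {Λ : ℝ} (hΛ : 0 < Λ) (j : Fin N)
    (a : Fin 3) : IsRegular (fun X σ => fieldB Λ (X j) a (Φ X σ)) :=
  (hΦ.annihilate (isFormFactor_formB hΛ j a)).add (hΦ.create (isFormFactor_formB hΛ j a))

lemma IsRegular.spinOp {Φ : State N} (hΦ : IsRegular Φ) (j : Fin N) (a : Fin 3) :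
    IsRegular (spinOp j a Φ) := by
  obtain ⟨⟨M, hM⟩, h⟩ := hΦ
  refine ⟨⟨M, fun n hn X σ => ?_⟩, fun n σ l => ?_⟩
  · simp only [QED.spinOp, Finset.sum_apply, Pi.smul_apply, hM n hn, smul_zero,
      Finset.sum_const_zero]
  · simp only [QED.spinOp, Finset.sum_apply, Pi.smul_apply]
    exact memLp_finsetSum _ fun t _ =>
      (h n (Function.update σ j t) l).const_smul (pauli a (σ j) t)

/-! ### The form core -/

/-- The tangent vector of configuration space moving particle `j` in the direction `a`. -/
abbrev direction (j : Fin N) (a : Fin 3) : Config N := Pi.single j (EuclideanSpace.single a 1)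

/-- The state `G Ψ`, for a real function `G` of the particle positions. -/
def localize (G : Config N → ℝ) (Ψ : State N) : State N := fun X σ => (G X : ℂ) • Ψ X σ

lemma IsTest.ofReal_mul {Y : Type*} [NormedAddCommGroup Y] [NormedSpace ℝ Y] {f : Y → ℂ}
    (hf : IsTest f) {G : Y → ℝ} (hG : ContDiff ℝ ∞ G) : IsTest fun y => (G y : ℂ) * f y :=
  ⟨(Complex.ofRealCLM.contDiff.comp hG).mul hf.1, hf.2.mul_left⟩

lemma IsTest.lineDeriv {Y : Type*} [NormedAddCommGroup Y] [NormedSpace ℝ Y] {f : Y → ℂ}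
    (hf : IsTest f) (v : Y) : IsTest fun y => lineDeriv ℝ f y v := by
  have h : (fun y => _root_.lineDeriv ℝ f y v) = fun y => fderiv ℝ f y v :=
    funext fun y => ((hf.1.differentiable (by simp)) y).lineDeriv_eq_fderiv
  rw [h]
  exact ⟨(hf.1.fderiv_right (m := ∞) (by simp)).clm_apply contDiff_const, hf.2.fderiv_apply ℝ v⟩

lemma IsTest.const_mul {Y : Type*} [NormedAddCommGroup Y] [NormedSpace ℝ Y] {f : Y → ℂ}
    (hf : IsTest f) (c : ℂ) : IsTest fun y => c * f y :=
  ⟨contDiff_const.mul hf.1, hf.2.mul_left⟩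

lemma localize_mem_core {m : ℝ} {Ψ : State N} (hΨ : Ψ ∈ core N m) {G : Config N → ℝ}
    (hG : ContDiff ℝ ∞ G) : localize G Ψ ∈ core N m := by
  induction hΨ using Submodule.span_induction with
  | mem Ψ h =>
    obtain ⟨f, s, η, hf, hη, rfl⟩ := h
    refine Submodule.subset_span ⟨_, s, η, hf.ofReal_mul hG, hη, ?_⟩
    funext X σ
    simp only [localize, productState]
    split_ifs <;> simp [mul_smul]
  | zero =>
    convert Submodule.zero_mem (core N m)
    funext X σ
    simp [localize]
  | add Φ Ψ _ _ h1 h2 =>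
    convert Submodule.add_mem _ h1 h2
    funext X σ
    simp [localize]
  | smul c Ψ _ h =>
    convert Submodule.smul_mem _ c h using 1
    funext X σ
    simp [localize, smul_comm c]

lemma differentiable_of_mem_core {m : ℝ} {Ψ : State N} (hΨ : Ψ ∈ core N m) (σ : Spins N) (n : ℕ)
    (k : Fin n → E3) (l : Fin n → Fin 2) : Differentiable ℝ fun Y => Ψ Y σ n k l := by
  induction hΨ using Submodule.span_induction with
  | mem Ψ h =>
    obtain ⟨f, s, η, hf, hη, rfl⟩ := h
    simp only [productState]
    split_ifs
    · simpa using (hf.1.differentiable (by simp)).mul_const (η n k l)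
    · simp
  | zero => simp
  | add Φ Ψ _ _ h1 h2 => exact h1.add h2
  | smul c Ψ _ h => exact h.const_smul c

lemma momentum_mem_core {m : ℝ} {Ψ : State N} (hΨ : Ψ ∈ core N m) (j : Fin N) (a : Fin 3) :
    momentum j a Ψ ∈ core N m := by
  induction hΨ using Submodule.span_induction with
  | mem Ψ h =>
    obtain ⟨f, s, η, hf, hη, rfl⟩ := h
    refine Submodule.subset_span ⟨_, s, η,
      (hf.lineDeriv (direction j a)).const_mul (-Complex.I), hη, ?_⟩
    funext X σ n k l
    simp only [momentum, productState]
    split_ifs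
    · have : lineDeriv ℝ (fun Y => (f Y • η) n k l) X (direction j a)
          = lineDeriv ℝ f X (direction j a) * η n k l := by
        simp only [lineDeriv, Pi.smul_apply, smul_eq_mul]
        exact deriv_mul_const_field _
      rw [this]
      simp [mul_assoc]
    · simp [lineDeriv]
  | zero =>
    convert Submodule.zero_mem (core N m)
    funext X σ n k l
    simp [momentum, lineDeriv]
  | add Φ Ψ h1 h2 h3 h4 =>
    convert Submodule.add_mem _ h3 h4 using 1
    funext X σ n k l
    have d1 := differentiable_of_mem_core h1 σ n k l X
    have d2 := differentiable_of_mem_core h2 σ n k l X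
    simp only [momentum, Pi.add_apply]
    rw [d1.lineDeriv_eq_fderiv, d2.lineDeriv_eq_fderiv, (d1.fun_add d2).lineDeriv_eq_fderiv,
      fderiv_fun_add d1 d2]
    simp [mul_add]
  | smul c Ψ _ h =>
    convert Submodule.smul_mem _ c h using 1
    funext X σ n k l
    simp only [momentum, Pi.smul_apply, smul_eq_mul, lineDeriv]
    rw [deriv_const_mul_field]
    ring

/-- Multiplication of a state by a function of particle positions and photon momenta. -/
def weight (w : Config N → (n : ℕ) → (Fin n → E3) → ℝ) : State N →ₗ[ℂ] State N where
  toFun Ψ := fun X σ n k l => (w X n k : ℂ) * Ψ X σ n k l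
  map_add' Φ Ψ := by
    funext X σ n k l
    simp [mul_add]
  map_smul' c Ψ := by
    funext X σ n k l
    simp [mul_left_comm]

lemma IsRegular.weight {m : ℝ} {u : Config N → ℝ} {w : (n : ℕ) → (Fin n → E3) → ℝ}
    (hu : ∀ f : Config N → ℂ, IsTest f → MemLp (fun X => (u X : ℂ) * f X) 2 volume)
    (hw : ∀ η : Fock, IsFiniteFock m η → ∀ n l, MemLp (fun k => (w n k : ℂ) * η n k l) 2 volume)
    {Ψ : State N} (hΨ : Ψ ∈ core N m) :
    IsRegular (weight (fun X n k => u X * w n k) Ψ) := by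
  induction hΨ using Submodule.span_induction with
  | mem Ψ h =>
    obtain ⟨f, s, η, hf, hη, rfl⟩ := h
    obtain ⟨M, hM⟩ := hη.1
    refine ⟨⟨M, fun n hn X σ => ?_⟩, fun n σ l => ?_⟩
    · funext k l
      simp only [QED.weight, productState, LinearMap.coe_mk, AddHom.coe_mk]
      split_ifs <;> simp [hM n hn]
    · by_cases hσ : σ = s
      · refine (memLp_mul_prod (hu f hf) (hw η hη n l)).ae_eq (ae_of_all _ fun p => ?_)
        simp [QED.weight, productState, hσ]
        ring
      · simp only [QED.weight, productState, LinearMap.coe_mk, AddHom.coe_mk, if_neg hσ]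
        simp
  | zero => rw [map_zero]; exact IsRegular.zero
  | add Φ Ψ _ _ h1 h2 => rw [map_add]; exact h1.add h2
  | smul c Ψ _ h => rw [map_smul]; exact h.smul c

lemma IsTest.memLp {Y : Type*} [NormedAddCommGroup Y] [NormedSpace ℝ Y] [MeasurableSpace Y]
    [BorelSpace Y] {μ : Measure Y} [IsFiniteMeasureOnCompacts μ] {f : Y → ℂ} (hf : IsTest f) :
    MemLp f 2 μ :=
  hf.1.continuous.memLp_of_hasCompactSupport hf.2

lemma isRegular_of_mem_core {m : ℝ} {Ψ : State N} (hΨ : Ψ ∈ core N m) : IsRegular Ψ := by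
  have := IsRegular.weight (u := fun _ => 1) (w := fun _ _ => 1)
    (fun f hf => by simpa using hf.memLp) (fun η hη n l => by simpa using hη.2.2.1 n l) hΨ
  convert this
  funext X σ n k l
  simp [weight]

lemma isRegular_sqrt_smul {m : ℝ} {Ψ : State N} (hΨ : Ψ ∈ core N m) {W : Config N → ℝ}
    (hW : LocallyIntegrable W volume) : IsRegular (localize (fun X => √|W X|) Ψ) := by
  have := IsRegular.weight (u := fun X => √|W X|) (w := fun _ _ => 1)
    (fun f hf => ?_) (fun η hη n l => by simpa using hη.2.2.1 n l) hΨ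
  · convert this
    funext X σ n k l
    simp [weight, localize]
  · have hm : AEStronglyMeasurable (fun X => ((√|W X| : ℝ) : ℂ) * f X) volume :=
      ((Complex.continuous_ofReal.comp (Real.continuous_sqrt.comp continuous_abs)
        ).comp_aestronglyMeasurable hW.aestronglyMeasurable).mul
        hf.1.continuous.aestronglyMeasurable
    rw [memLp_two_iff_integrable_sq_norm hm]
    have h1 := hW.integrable_smul_left_of_hasCompactSupport (g := fun X => ‖f X‖ ^ 2)
      (hf.1.continuous.norm.pow 2) (hf.2.norm.comp_left (g := fun r => r ^ 2) (by simp))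
    refine h1.norm.congr (ae_of_all _ fun X => ?_)
    simp only [smul_eq_mul, norm_mul, norm_pow, Complex.norm_real, Real.norm_eq_abs,
      mul_pow, sq_abs, Real.sq_sqrt (abs_nonneg (W X))]
    ring

/-- Multiplication by the square root of the photon energy, so that `‖√H_f η‖² = (η, H_f η)`. -/
def sqrtFieldEnergy (m : ℝ) (η : Fock) : Fock :=
  fun n k l => (√(∑ i, omega m (k i)) : ℂ) * η n k l

lemma sum_omega_nonneg {n : ℕ} (m : ℝ) (k : Fin n → E3) : 0 ≤ ∑ i, omega m (k i) :=
  Finset.sum_nonneg fun _ _ => Real.sqrt_nonneg _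

lemma fieldEnergy_eq (m : ℝ) (η : Fock) : fieldEnergy m η = fockNormSq (sqrtFieldEnergy m η) := by
  simp only [fieldEnergy, fockNormSq, sqrtFieldEnergy, norm_mul, mul_pow, Complex.norm_real,
    Real.norm_eq_abs, sq_abs]
  have : ∀ (n : ℕ) (k : Fin n → E3), √(∑ i, omega m (k i)) ^ 2 = ∑ i, omega m (k i) :=
    fun n k => Real.sq_sqrt (sum_omega_nonneg m k)
  simp only [this]

lemma continuous_omega (m : ℝ) : Continuous (omega m) := by
  unfold omega
  fun_prop

lemma isRegular_sqrtFieldEnergy {m : ℝ} {Ψ : State N} (hΨ : Ψ ∈ core N m) :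
    IsRegular (fun X σ => sqrtFieldEnergy m (Ψ X σ)) := by
  have := IsRegular.weight (u := fun _ => 1) (w := fun _ k => √(∑ i, omega m (k i)))
    (fun f hf => by simpa using hf.memLp) (fun η hη n l => ?_) hΨ
  · convert this using 1
    funext X σ n k l
    simp [weight, sqrtFieldEnergy]
  · have hc : Continuous fun k : Fin n → E3 => ((√(∑ i, omega m (k i)) : ℝ) : ℂ) :=
      Complex.continuous_ofReal.comp (Real.continuous_sqrt.comp
        (continuous_finsetSum _ fun i _ => (continuous_omega m).comp (continuous_apply i)))
    have hm : AEStronglyMeasurable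
        (fun k => ((√(∑ i, omega m (k i)) : ℝ) : ℂ) * η n k l) volume :=
      hc.aestronglyMeasurable.mul (hη.2.2.1 n l).1
    rw [memLp_two_iff_integrable_sq_norm hm]
    refine (hη.2.2.2 n l).congr (ae_of_all _ fun k => ?_)
    simp only [norm_mul, mul_pow, Complex.norm_real, Real.norm_eq_abs, sq_abs]
    rw [Real.sq_sqrt (sum_omega_nonneg m k)]

lemma isRegular_covMomentum {m : ℝ} {Ψ : State N} (hΨ : Ψ ∈ core N m) (α : ℝ) {Λ : ℝ}
    (hΛ : 0 < Λ) (j : Fin N) (a : Fin 3) : IsRegular (covMomentum α Λ j a Ψ) :=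
  (isRegular_of_mem_core (momentum_mem_core hΨ j a)).add
    (((isRegular_of_mem_core hΨ).fieldA hΛ j a).smul _)

/-! ### Energy densities in configuration space -/

/-- The particle density `∑_σ ‖Ψ(X, σ)‖²`. -/
def density (Ψ : State N) (X : Config N) : ℝ := ∑ σ, fockNormSq (Ψ X σ)

/-- Twice the real part of `((p_j + √α A(x_j)) Ψ, -i Ψ)` at the configuration `X`. -/
def current (α Λ : ℝ) (j : Fin N) (a : Fin 3) (Ψ : State N) (X : Config N) : ℝ :=
  ∑ σ, 2 * (fockInner (covMomentum α Λ j a Ψ X σ) (-Complex.I • Ψ X σ)).re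

/-- The density of the Zeeman energy of particle `j`. -/
def zeemanDensity (Λ : ℝ) (j : Fin N) (Ψ : State N) (X : Config N) : ℝ :=
  (∑ σ, ∑ a, fockInner (Ψ X σ) (fieldB Λ (X j) a (spinOp j a Ψ X σ))).re

/-- The density of the total energy, with potential `W`. -/
def energyDensity (α g Λ m : ℝ) (W : Config N → ℝ) (Ψ : State N) (X : Config N) : ℝ :=
  (∑ j, ((∑ a, density (covMomentum α Λ j a Ψ) X) + g / 2 * √α * zeemanDensity Λ j Ψ X))
    + W X * density Ψ X + ∑ σ, fieldEnergy m (Ψ X σ)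

lemma density_nonneg (Ψ : State N) (X : Config N) : 0 ≤ density Ψ X :=
  Finset.sum_nonneg fun _ _ => fockNormSq_nonneg _

lemma IsRegular.integrable_density {Φ : State N} (hΦ : IsRegular Φ) : Integrable (density Φ) :=
  integrable_finsetSum _ fun σ _ => hΦ.integrable_fockNormSq σ

lemma density_localize (G : Config N → ℝ) (Ψ : State N) (X : Config N) :
    density (localize G Ψ) X = G X ^ 2 * density Ψ X := by
  simp only [density, localize, fockNormSq_smul, Finset.mul_sum, Complex.norm_real,
    Real.norm_eq_abs, sq_abs]

lemma integrable_mul_density {m : ℝ} {Ψ : State N} (hΨ : Ψ ∈ core N m)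
    {W : Config N → ℝ} (hW : LocallyIntegrable W volume) :
    Integrable fun X => W X * density Ψ X := by
  refine (isRegular_sqrt_smul hΨ hW).integrable_density.mono'
    (hW.aestronglyMeasurable.mul (isRegular_of_mem_core hΨ).integrable_density.1)
    (ae_of_all _ fun X => ?_)
  rw [density_localize, Real.sq_sqrt (abs_nonneg _), norm_mul, Real.norm_eq_abs,
    Real.norm_of_nonneg (density_nonneg _ _)]

lemma integrable_current {m : ℝ} {Ψ : State N} (hΨ : Ψ ∈ core N m)
    (α : ℝ) {Λ : ℝ} (hΛ : 0 < Λ) (j : Fin N) (a : Fin 3) :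
    Integrable (current α Λ j a Ψ) :=
  integrable_finsetSum _ fun σ _ =>
    (((isRegular_covMomentum hΨ α hΛ j a).integrable_fockInner
      ((isRegular_of_mem_core hΨ).smul (-Complex.I)) σ).re.const_mul 2)

lemma integrable_zeeman {m : ℝ} {Ψ : State N} (hΨ : Ψ ∈ core N m)
    {Λ : ℝ} (hΛ : 0 < Λ) (j : Fin N) :
    Integrable fun X => ∑ σ, ∑ a, fockInner (Ψ X σ) (fieldB Λ (X j) a (spinOp j a Ψ X σ)) :=
  integrable_finsetSum _ fun σ _ => integrable_finsetSum _ fun a _ =>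
    (isRegular_of_mem_core hΨ).integrable_fockInner
      (((isRegular_of_mem_core hΨ).spinOp j a).fieldB hΛ j a) σ

lemma integrable_fieldEnergy {m : ℝ} {Ψ : State N} (hΨ : Ψ ∈ core N m) :
    Integrable fun X => ∑ σ, fieldEnergy m (Ψ X σ) := by
  simp only [fieldEnergy_eq]
  exact (isRegular_sqrtFieldEnergy hΨ).integrable_density

lemma integrable_energyDensity {m : ℝ} {Ψ : State N} (hΨ : Ψ ∈ core N m)
    (α g : ℝ) {Λ : ℝ} (hΛ : 0 < Λ) {W : Config N → ℝ} (hW : LocallyIntegrable W volume) :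
    Integrable (energyDensity α g Λ m W Ψ) :=
  ((integrable_finsetSum _ fun j _ => (integrable_finsetSum _ fun a _ =>
    (isRegular_covMomentum hΨ α hΛ j a).integrable_density).add
      ((integrable_zeeman hΨ hΛ j).re.const_mul _)).add (integrable_mul_density hΨ hW)).add
    (integrable_fieldEnergy hΨ)

lemma energy_eq_integral {m : ℝ} {Ψ : State N} (hΨ : Ψ ∈ core N m)
    (α g : ℝ) {Λ : ℝ} (hΛ : 0 < Λ) {v : E3 → ℝ} {I : Config N → ℝ}
    (hV : LocallyIntegrable (externalPotential N v) volume) (hI : LocallyIntegrable I volume) :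
    energy α g Λ m v I Ψ = ∫ X, energyDensity α g Λ m (externalPotential N v + I) Ψ X := by
  have hk : ∀ j a, Integrable (density (covMomentum α Λ j a Ψ)) := fun j a =>
    (isRegular_covMomentum hΨ α hΛ j a).integrable_density
  have hz : ∀ j, Integrable (zeemanDensity Λ j Ψ) := fun j => (integrable_zeeman hΨ hΛ j).re
  have hz' : ∀ j, zeemanEnergy Λ j Ψ = ∫ X, zeemanDensity Λ j Ψ X := fun j =>
    (integral_re (integrable_zeeman hΨ hΛ j)).symm
  have hsum : ∀ j, Integrable fun X => (∑ a, density (covMomentum α Λ j a Ψ) X) +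
      g / 2 * √α * zeemanDensity Λ j Ψ X := fun j =>
    (integrable_finsetSum _ fun a _ => hk j a).add ((hz j).const_mul _)
  have hW := (integrable_mul_density hΨ hV)
  have hW' := (integrable_mul_density hΨ hI)
  have hs := integrable_finsetSum Finset.univ fun j _ => hsum j
  have hWW : Integrable fun X => externalPotential N v X * density Ψ X + I X * density Ψ X :=
    hW.add hW'
  have hsW : Integrable fun X =>
      (∑ j, ((∑ a, density (covMomentum α Λ j a Ψ) X) + g / 2 * √α * zeemanDensity Λ j Ψ X)) +
        (externalPotential N v X * density Ψ X + I X * density Ψ X) := hs.add hWW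
  simp only [energyDensity, Pi.add_apply, add_mul]
  rw [integral_add hsW (integrable_fieldEnergy hΨ),
    integral_add hs hWW, integral_add hW hW', integral_finsetSum _ fun j _ => hsum j,
    energy]
  have hj : ∀ j, (∫ X, (∑ a, density (covMomentum α Λ j a Ψ) X) +
      g / 2 * √α * zeemanDensity Λ j Ψ X)
      = kineticEnergy α Λ j Ψ + g / 2 * √α * zeemanEnergy Λ j Ψ := fun j => by
    rw [integral_add (integrable_finsetSum _ fun a _ => hk j a) ((hz j).const_mul _),
      integral_finsetSum _ fun a _ => hk j a, integral_const_mul, hz']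
    rfl
  simp only [hj]
  simp only [potentialEnergy, density]
  ring

/-! ### Localization -/

lemma annihilate_smul (h : E3 → Fin 2 → ℂ) (c : ℂ) (η : Fock) :
    annihilate h (c • η) = c • annihilate h η := by
  funext n k l
  simp only [annihilate, Pi.smul_apply, smul_eq_mul, mul_left_comm _ c, integral_const_mul,
    ← Finset.mul_sum]

lemma create_smul (h : E3 → Fin 2 → ℂ) (c : ℂ) (η : Fock) :
    create h (c • η) = c • create h η := by
  funext n
  cases n with
  | zero => simp [create]
  | succ n =>
    funext k l
    simp only [create, Pi.smul_apply, smul_eq_mul, mul_left_comm _ c, ← Finset.mul_sum]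

lemma fieldA_smul (Λ : ℝ) (x : E3) (a : Fin 3) (c : ℂ) (η : Fock) :
    fieldA Λ x a (c • η) = c • fieldA Λ x a η := by
  simp only [fieldA, annihilate_smul, create_smul, smul_add]

lemma fieldB_smul (Λ : ℝ) (x : E3) (a : Fin 3) (c : ℂ) (η : Fock) :
    fieldB Λ x a (c • η) = c • fieldB Λ x a η := by
  simp only [fieldB, annihilate_smul, create_smul, smul_add]

lemma spinOp_localize (G : Config N → ℝ) (Ψ : State N) (j : Fin N) (a : Fin 3) (X : Config N)
    (σ : Spins N) : spinOp j a (localize G Ψ) X σ = (G X : ℂ) • spinOp j a Ψ X σ := by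
  simp only [spinOp, localize, Finset.smul_sum, smul_comm (G X : ℂ)]

/-- The Leibniz rule for the covariant momentum. -/
lemma covMomentum_localize {m : ℝ} {Ψ : State N} (hΨ : Ψ ∈ core N m) {G : Config N → ℝ}
    (hG : Differentiable ℝ G) (α Λ : ℝ) (j : Fin N) (a : Fin 3) (X : Config N) (σ : Spins N) :
    covMomentum α Λ j a (localize G Ψ) X σ = (G X : ℂ) • covMomentum α Λ j a Ψ X σ
      + (-Complex.I * (lineDeriv ℝ G X (direction j a) : ℝ)) • Ψ X σ := by
  have hm : momentum j a (localize G Ψ) X σ = (G X : ℂ) • momentum j a Ψ X σ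
      + (-Complex.I * (lineDeriv ℝ G X (direction j a) : ℝ)) • Ψ X σ := by
    funext n k l
    simp only [momentum, localize, Pi.add_apply, Pi.smul_apply, smul_eq_mul]
    have h1 : HasDerivAt (fun t : ℝ => ((G (X + t • direction j a) : ℝ) : ℂ))
        ((lineDeriv ℝ G X (direction j a) : ℝ) : ℂ) 0 :=
      HasDerivAt.ofReal_comp (hG X).lineDifferentiableAt.hasLineDerivAt
    have h2 : HasDerivAt (fun t : ℝ => Ψ (X + t • direction j a) σ n k l)
        (lineDeriv ℝ (fun Y => Ψ Y σ n k l) X (direction j a)) 0 :=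
      (differentiable_of_mem_core hΨ σ n k l X).lineDifferentiableAt.hasLineDerivAt
    have h3 : lineDeriv ℝ (fun Y => (G Y : ℂ) * Ψ Y σ n k l) X (direction j a) = _ :=
      (h1.mul h2).deriv
    rw [h3]
    simp only [zero_smul, add_zero]
    ring
  rw [covMomentum, hm, covMomentum, show localize G Ψ X σ = (G X : ℂ) • Ψ X σ from rfl,
    fieldA_smul]
  module

lemma fieldEnergy_smul (m : ℝ) (c : ℂ) (η : Fock) :
    fieldEnergy m (c • η) = ‖c‖ ^ 2 * fieldEnergy m η := by
  have : sqrtFieldEnergy m (c • η) = c • sqrtFieldEnergy m η := by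
    funext n k l
    simp [sqrtFieldEnergy, mul_left_comm]
  rw [fieldEnergy_eq, fieldEnergy_eq, this, fockNormSq_smul]

lemma zeemanDensity_localize (Λ : ℝ) (j : Fin N) (G : Config N → ℝ) (Ψ : State N)
    (X : Config N) : zeemanDensity Λ j (localize G Ψ) X = G X ^ 2 * zeemanDensity Λ j Ψ X := by
  simp only [zeemanDensity, spinOp_localize, fieldB_smul]
  simp only [localize, fockInner_smul_smul, ← Finset.mul_sum]
  rw [show conj (G X : ℂ) * (G X : ℂ) = ((G X ^ 2 : ℝ) : ℂ) by simp [sq], Complex.re_ofReal_mul]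

/-- The localization formula: the energy density of `G Ψ`. The term with the current integrates
to zero only after averaging over the translates of `G`. -/
lemma energyDensity_localize {m : ℝ} {Ψ : State N} (hΨ : Ψ ∈ core N m) {G : Config N → ℝ}
    (hG : Differentiable ℝ G) (α g : ℝ) {Λ : ℝ} (hΛ : 0 < Λ) :
    ∀ᵐ X, ∀ W, energyDensity α g Λ m W (localize G Ψ) X
      = G X ^ 2 * energyDensity α g Λ m W Ψ X
        + ∑ j, ∑ a, (lineDeriv ℝ G X (direction j a) ^ 2 * density Ψ X
          + G X * lineDeriv ℝ G X (direction j a) * current α Λ j a Ψ X) := by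
  have hcov : ∀ᵐ X, ∀ j a σ, IsL2Fock (covMomentum α Λ j a Ψ X σ) := by
    simp only [ae_all_iff (ι := Fin N), ae_all_iff (ι := Fin 3)]
    exact fun j a => (isRegular_covMomentum hΨ α hΛ j a).ae_isL2Fock
  filter_upwards [hcov, (isRegular_of_mem_core hΨ).ae_isL2Fock] with X hX1 hX2 W
  have hk : ∀ j a, density (covMomentum α Λ j a (localize G Ψ)) X
      = G X ^ 2 * density (covMomentum α Λ j a Ψ) X
        + (lineDeriv ℝ G X (direction j a) ^ 2 * density Ψ X
          + G X * lineDeriv ℝ G X (direction j a) * current α Λ j a Ψ X) := by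
    intro j a
    simp only [density, current, Finset.mul_sum, ← Finset.sum_add_distrib]
    refine Finset.sum_congr rfl fun σ _ => ?_
    rw [covMomentum_localize hΨ hG, fockNormSq_smul_add_smul (hX1 j a σ) (hX2 σ)]
    ring
  have hf : ∑ σ, fieldEnergy m (localize G Ψ X σ) = G X ^ 2 * ∑ σ, fieldEnergy m (Ψ X σ) := by
    simp only [localize, fieldEnergy_smul, Finset.mul_sum, Complex.norm_real, Real.norm_eq_abs,
      sq_abs]
  simp only [energyDensity, hk, hf, zeemanDensity_localize, density_localize,
    Finset.sum_add_distrib, ← Finset.mul_sum]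
  ring

lemma IsAntisymm.localize {Ψ : State N} (hΨ : IsAntisymm Ψ) {G : Config N → ℝ}
    (hG : ∀ (π : Equiv.Perm (Fin N)) X, G (X ∘ π) = G X) : IsAntisymm (localize G Ψ) := by
  intro π X σ
  simp only [QED.localize, hG, hΨ π X σ, smul_comm (G X : ℂ)]

/-! ### Translations of the particles together with the radiation field -/

/-- The configuration with all particles translated by `y`. -/
def shift (y : E3) (X : Config N) : Config N := fun j => X j + y

/-- Translation by `y` in the Fock space, `exp(-i y · P_f)`. -/
def fockTranslate (y : E3) (η : Fock) : Fock := fun n k l =>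
  Complex.exp (-Complex.I * (∑ i, inner ℝ (k i) y : ℝ)) * η n k l

/-- Translation by `y` of all particles and of the radiation field. -/
def translate (y : E3) (Ψ : State N) : State N :=
  fun X σ => fockTranslate y (Ψ (shift (-y) X) σ)

lemma shift_shift (y z : E3) (X : Config N) : shift y (shift z X) = shift (z + y) X := by
  funext j
  simp [shift, add_assoc]

lemma shift_zero (X : Config N) : shift 0 X = X := by
  funext j
  simp [shift]

lemma translate_shift (y : E3) (Ψ : State N) (X : Config N) (σ : Spins N) :
    translate y Ψ (shift y X) σ = fockTranslate y (Ψ X σ) := by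
  simp [translate, shift_shift, shift_zero]

lemma norm_phase (r : ℝ) : ‖Complex.exp (-Complex.I * (r : ℂ))‖ = 1 := by
  rw [show -Complex.I * (r : ℂ) = ((-r : ℝ) : ℂ) * Complex.I by push_cast; ring,
    Complex.norm_exp_ofReal_mul_I]

lemma fockTranslate_add (y : E3) (η ζ : Fock) :
    fockTranslate y (η + ζ) = fockTranslate y η + fockTranslate y ζ := by
  funext n k l
  simp [fockTranslate, mul_add]

lemma fockTranslate_smul (y : E3) (c : ℂ) (η : Fock) :
    fockTranslate y (c • η) = c • fockTranslate y η := by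
  funext n k l
  simp [fockTranslate, mul_left_comm]

lemma fockTranslate_zero (y : E3) : fockTranslate y 0 = 0 := by
  funext n k l
  simp [fockTranslate]

lemma fockTranslate_sum {ι : Type*} (y : E3) (s : Finset ι) (η : ι → Fock) :
    fockTranslate y (∑ i ∈ s, η i) = ∑ i ∈ s, fockTranslate y (η i) :=
  map_sum (AddMonoidHom.mk' (fockTranslate y) (fockTranslate_add y)) η s

lemma fockInner_fockTranslate (y : E3) (η ζ : Fock) :
    fockInner (fockTranslate y η) (fockTranslate y ζ) = fockInner η ζ := by
  simp only [fockInner, fockTranslate]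
  refine tsum_congr fun n => Finset.sum_congr rfl fun l _ => ?_
  congr 1 with k
  set e := Complex.exp (-Complex.I * (∑ i, inner ℝ (k i) y : ℝ)) with he
  have h1 : conj e * e = 1 := by
    rw [Complex.conj_mul', he, norm_phase]
    simp
  calc conj (e * η n k l) * (e * ζ n k l) = (conj e * e) * (conj (η n k l) * ζ n k l) := by
        rw [map_mul]
        ring
    _ = _ := by rw [h1, one_mul]

lemma fockNormSq_fockTranslate (y : E3) (η : Fock) :
    fockNormSq (fockTranslate y η) = fockNormSq η := by
  simp only [fockNormSq, fockTranslate, norm_mul, norm_phase, one_mul]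

lemma fieldEnergy_fockTranslate (m : ℝ) (y : E3) (η : Fock) :
    fieldEnergy m (fockTranslate y η) = fieldEnergy m η := by
  simp only [fieldEnergy, fockTranslate, norm_mul, norm_phase, one_mul]

lemma annihilate_fockTranslate {h h' : E3 → Fin 2 → ℂ} {y : E3}
    (hh : ∀ q μ, h q μ = Complex.exp (-Complex.I * (inner ℝ q y : ℝ)) * h' q μ) (η : Fock) :
    annihilate h (fockTranslate y η) = fockTranslate y (annihilate h' η) := by
  funext n k l
  simp only [annihilate, fockTranslate]
  rw [mul_left_comm]
  congr 1
  rw [Finset.mul_sum]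
  refine Finset.sum_congr rfl fun μ _ => ?_
  rw [← integral_const_mul]
  congr 1 with q
  rw [hh, Fin.sum_univ_succ]
  simp only [Fin.cons_zero, Fin.cons_succ]
  have h1 : conj (Complex.exp (-Complex.I * (inner ℝ q y : ℝ)))
      * Complex.exp (-Complex.I * (inner ℝ q y : ℝ)) = 1 := by
    rw [Complex.conj_mul', norm_phase]
    simp
  rw [map_mul, Complex.ofReal_add, mul_add, Complex.exp_add]
  linear_combination (conj (h' q μ)
    * (Complex.exp (-Complex.I * ((∑ i, inner ℝ (k i) y : ℝ) : ℂ))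
      * η (n + 1) (Fin.cons q k) (Fin.cons μ l))) * h1

lemma create_fockTranslate {h h' : E3 → Fin 2 → ℂ} {y : E3}
    (hh : ∀ q μ, h q μ = Complex.exp (-Complex.I * (inner ℝ q y : ℝ)) * h' q μ) (η : Fock) :
    create h (fockTranslate y η) = fockTranslate y (create h' η) := by
  funext n
  cases n with
  | zero =>
    funext k l
    simp [create, fockTranslate]
  | succ n =>
    funext k l
    simp only [create, fockTranslate]
    rw [mul_left_comm]
    congr 1
    rw [Finset.mul_sum]
    refine Finset.sum_congr rfl fun i _ => ?_
    rw [hh, Fin.sum_univ_succAbove _ i, Complex.ofReal_add, mul_add, Complex.exp_add]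
    simp only [Fin.removeNth]
    ring

lemma fieldFactor_add (Λ : ℝ) (x y k : E3) :
    fieldFactor Λ (x + y) k
      = Complex.exp (-Complex.I * (inner ℝ k y : ℝ)) * fieldFactor Λ x k := by
  unfold fieldFactor
  split_ifs
  · rw [inner_add_right, Complex.ofReal_add, mul_add, Complex.exp_add]
    ring
  · simp

lemma fieldA_fockTranslate (Λ : ℝ) (x y : E3) (a : Fin 3) (η : Fock) :
    fieldA Λ (x + y) a (fockTranslate y η) = fockTranslate y (fieldA Λ x a η) := by
  have hh : ∀ q μ, formA Λ (x + y) a q μ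
      = Complex.exp (-Complex.I * (inner ℝ q y : ℝ)) * formA Λ x a q μ := fun q μ => by
    rw [formA, formA, fieldFactor_add]
    ring
  rw [fieldA, fieldA, annihilate_fockTranslate hh, create_fockTranslate hh, fockTranslate_add]

lemma fieldB_fockTranslate (Λ : ℝ) (x y : E3) (a : Fin 3) (η : Fock) :
    fieldB Λ (x + y) a (fockTranslate y η) = fockTranslate y (fieldB Λ x a η) := by
  have hh : ∀ q μ, formB Λ (x + y) a q μ
      = Complex.exp (-Complex.I * (inner ℝ q y : ℝ)) * formB Λ x a q μ := fun q μ => by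
    rw [formB, formB, fieldFactor_add]
    ring
  rw [fieldB, fieldB, annihilate_fockTranslate hh, create_fockTranslate hh, fockTranslate_add]

lemma momentum_translate (y : E3) (Ψ : State N) (j : Fin N) (a : Fin 3) :
    momentum j a (translate y Ψ) = translate y (momentum j a Ψ) := by
  funext X σ n k l
  simp only [momentum, translate, fockTranslate, lineDeriv]
  rw [deriv_const_mul_field]
  have : ∀ t : ℝ, shift (-y) (X + t • direction j a)
      = shift (-y) X + t • direction j a := fun t => by
    funext i
    simp [shift, add_right_comm]
  simp only [this]
  ring

lemma covMomentum_translate (α Λ : ℝ) (y : E3) (Ψ : State N) (j : Fin N) (a : Fin 3)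
    (X : Config N) (σ : Spins N) : covMomentum α Λ j a (translate y Ψ) (shift y X) σ
      = fockTranslate y (covMomentum α Λ j a Ψ X σ) := by
  rw [covMomentum, momentum_translate, translate_shift, translate_shift, covMomentum,
    fockTranslate_add, fockTranslate_smul, show shift y X j = X j + y from rfl,
    fieldA_fockTranslate]

lemma spinOp_translate (y : E3) (Ψ : State N) (j : Fin N) (a : Fin 3)
    (X : Config N) (σ : Spins N) : spinOp j a (translate y Ψ) (shift y X) σ
      = fockTranslate y (spinOp j a Ψ X σ) := by
  simp only [spinOp, translate_shift, fockTranslate_sum, fockTranslate_smul]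

lemma density_translate (y : E3) (Ψ : State N) (X : Config N) :
    density (translate y Ψ) (shift y X) = density Ψ X := by
  simp only [density, translate_shift, fockNormSq_fockTranslate]

lemma current_translate (α Λ : ℝ) (y : E3) (Ψ : State N) (j : Fin N) (a : Fin 3)
    (X : Config N) :
    current α Λ j a (translate y Ψ) (shift y X) = current α Λ j a Ψ X := by
  simp only [current, covMomentum_translate, translate_shift, ← fockTranslate_smul,
    fockInner_fockTranslate]

lemma energyDensity_translate (α g Λ m : ℝ) (W : Config N → ℝ) (y : E3) (Ψ : State N)
    (X : Config N) : energyDensity α g Λ m W (translate y Ψ) (shift y X)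
      = energyDensity α g Λ m (fun X => W (shift y X)) Ψ X := by
  simp only [energyDensity, density_translate, translate_shift, fieldEnergy_fockTranslate,
    zeemanDensity, spinOp_translate]
  simp only [density, covMomentum_translate, fockNormSq_fockTranslate, shift,
    fieldB_fockTranslate, fockInner_fockTranslate]

lemma translate_mem_core {m : ℝ} {Ψ : State N} (hΨ : Ψ ∈ core N m) (y : E3) :
    translate y Ψ ∈ core N m := by
  induction hΨ using Submodule.span_induction with
  | mem Ψ h =>
    obtain ⟨f, s, η, hf, hη, rfl⟩ := h
    have hshift : (shift (-y) : Config N → Config N) = fun X => X + fun _ => -y := rfl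
    refine Submodule.subset_span ⟨fun X => f (shift (-y) X), s, fockTranslate y η, ⟨?_, ?_⟩, ?_, ?_⟩
    · rw [hshift]
      exact hf.1.comp (contDiff_id.add contDiff_const)
    · rw [hshift]
      exact hf.2.comp_homeomorph (Homeomorph.addRight _)
    · obtain ⟨⟨M, hM⟩, h1, h2, h3⟩ := hη
      refine ⟨⟨M, fun n hn => ?_⟩, fun n π k l => ?_, fun n l => ?_, fun n l => ?_⟩
      · funext k l
        simp [fockTranslate, hM n hn]
      · have : ∑ i, inner ℝ ((k ∘ π) i) y = ∑ i, inner ℝ (k i) y :=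
          Equiv.sum_comp π fun i => inner ℝ (k i) y
        simp only [fockTranslate, h1 n π k l, this]
      · have hc : Continuous fun k : Fin n → E3 =>
            Complex.exp (-Complex.I * ((∑ i, inner ℝ (k i) y : ℝ) : ℂ)) := by fun_prop
        refine (h2 n l).mono (hc.aestronglyMeasurable.mul (h2 n l).1) (ae_of_all _ fun k => ?_)
        simp only [fockTranslate, norm_mul, norm_phase, one_mul, le_refl]
      · simpa only [fockTranslate, norm_mul, norm_phase, one_mul] using h3 n l
    · funext X σ
      simp only [translate, productState]
      split_ifs
      · rw [fockTranslate_smul]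
      · rw [fockTranslate_zero]
  | zero =>
    convert Submodule.zero_mem (core N m)
    funext X σ
    simp [translate, fockTranslate_zero]
  | add Φ Ψ _ _ h1 h2 =>
    convert Submodule.add_mem _ h1 h2
    funext X σ
    simp [translate, fockTranslate_add]
  | smul c Ψ _ h =>
    convert Submodule.smul_mem _ c h using 1
    funext X σ
    simp [translate, fockTranslate_smul]

lemma IsAntisymm.translate {Ψ : State N} (hΨ : IsAntisymm Ψ) (y : E3) :
    IsAntisymm (translate y Ψ) := by
  intro π X σ
  have : shift (-y) (X ∘ π) = shift (-y) X ∘ π := rfl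
  simp only [QED.translate, this, hΨ π, fockTranslate_smul]

/-! ### The variational principle and averaging over translations -/

lemma measurePreserving_shift (y : E3) :
    MeasurePreserving (shift y : Config N → Config N) volume volume :=
  measurePreserving_add_right volume (fun _ : Fin N => y)

lemma integral_shift (y : E3) (f : Config N → ℝ) : ∫ X, f (shift y X) = ∫ X, f X :=
  integral_add_right_eq_self f (fun _ : Fin N => y)

lemma integrable_comp_shift (y : E3) {f : Config N → ℝ} (hf : Integrable f) :
    Integrable fun X => f (shift y X) :=
  hf.comp_add_right (fun _ : Fin N => y)

lemma normSq_eq_integral_density (Ψ : State N) : normSq Ψ = ∫ X, density Ψ X := rfl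

lemma locallyIntegrable_comp_eval {v : E3 → ℝ} (hv : LocallyIntegrable v volume) (j : Fin N) :
    LocallyIntegrable (fun X : Config N => v (X j)) volume := by
  intro X
  refine ⟨Metric.closedBall X 1, Metric.closedBall_mem_nhds X one_pos, ?_⟩
  rw [closedBall_pi _ zero_le_one, IntegrableOn, volume_pi, Measure.restrict_pi_pi]
  have hfin : ∀ i, IsFiniteMeasure ((volume : Measure E3).restrict (Metric.closedBall (X i) 1)) :=
    fun i => ⟨by simp⟩
  have hint : Integrable v ((volume : Measure E3).restrict (Metric.closedBall (X j) 1)) :=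
    hv.integrableOn_isCompact (isCompact_closedBall _ _)
  exact integrable_comp_eval (i := j) hint

lemma locallyIntegrable_externalPotential {v : E3 → ℝ} (hv : LocallyIntegrable v volume) :
    LocallyIntegrable (externalPotential N v) volume := by
  have : externalPotential N v = fun X => ∑ j, v (X j) := rfl
  rw [this]
  exact locallyIntegrable_finsetSum _ fun j _ => locallyIntegrable_comp_eval hv j

/-- A vector of the form core with norm zero has nonnegative energy, as the terms of indefinite
sign vanish. -/
lemma energy_nonneg_of_normSq_eq_zero {m : ℝ} {Ψ : State N} (hΨ : Ψ ∈ core N m) (α g : ℝ)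
    {Λ : ℝ} (hΛ : 0 < Λ) {v : E3 → ℝ} {I : Config N → ℝ} (hv : LocallyIntegrable v volume)
    (hI : LocallyIntegrable I volume) (h0 : normSq Ψ = 0) : 0 ≤ energy α g Λ m v I Ψ := by
  rw [energy_eq_integral hΨ α g hΛ (locallyIntegrable_externalPotential hv) hI]
  have hreg := isRegular_of_mem_core hΨ
  rw [normSq_eq_integral_density, integral_eq_zero_iff_of_nonneg (density_nonneg Ψ)
    hreg.integrable_density] at h0
  refine integral_nonneg_of_ae ?_
  filter_upwards [h0, hreg.ae_isL2Fock] with X hX hL2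
  have hX' : density Ψ X = 0 := hX
  have hs : ∀ σ, fockNormSq (Ψ X σ) = 0 := fun σ =>
    (Finset.sum_eq_zero_iff_of_nonneg fun _ _ => fockNormSq_nonneg _).1 hX' σ (Finset.mem_univ σ)
  have hz : ∀ j, zeemanDensity Λ j Ψ X = 0 := fun j => by
    simp [zeemanDensity, fockInner_eq_zero (hL2 _) (hs _)]
  simp only [energyDensity, hX', hz, mul_zero, add_zero, Pi.zero_apply]
  refine add_nonneg (Finset.sum_nonneg fun j _ => Finset.sum_nonneg fun a _ =>
    density_nonneg _ _) (Finset.sum_nonneg fun σ _ => ?_)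
  rw [fieldEnergy_eq]
  exact fockNormSq_nonneg _

lemma energy_const_localize {m : ℝ} {Ψ : State N} (hΨ : Ψ ∈ core N m) (α g : ℝ)
    {Λ : ℝ} (hΛ : 0 < Λ) {v : E3 → ℝ} {I : Config N → ℝ} (hv : LocallyIntegrable v volume)
    (hI : LocallyIntegrable I volume) (c : ℝ) :
    energy α g Λ m v I (localize (fun _ => c) Ψ) = c ^ 2 * energy α g Λ m v I Ψ := by
  have hV := locallyIntegrable_externalPotential (N := N) hv
  rw [energy_eq_integral hΨ α g hΛ hV hI,
    energy_eq_integral (localize_mem_core hΨ contDiff_const) α g hΛ hV hI, ← integral_const_mul]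
  refine integral_congr_ae ?_
  filter_upwards [energyDensity_localize hΨ (G := fun _ => c) (by fun_prop) α g hΛ] with X hX
  simp [hX, lineDeriv]

lemma le_energy_of_le_groundEnergy {α g Λ m : ℝ} (hΛ : 0 < Λ) {v : E3 → ℝ} {I : Config N → ℝ}
    (hv : LocallyIntegrable v volume) (hI : LocallyIntegrable I volume) {t : ℝ}
    (ht : (t : EReal) ≤ groundEnergy N α g Λ m v I) {Ψ : State N} (hΨ : Ψ ∈ core N m)
    (hanti : IsAntisymm Ψ) : t * normSq Ψ ≤ energy α g Λ m v I Ψ := by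
  have hnn : 0 ≤ normSq Ψ := integral_nonneg (density_nonneg Ψ)
  rcases hnn.eq_or_lt with h0 | hpos
  · rw [← h0, mul_zero]
    exact energy_nonneg_of_normSq_eq_zero hΨ α g hΛ hv hI h0.symm
  · set c : ℝ := (√(normSq Ψ))⁻¹ with hc
    have hc2 : c ^ 2 = (normSq Ψ)⁻¹ := by rw [hc, inv_pow, Real.sq_sqrt hnn]
    have hnorm : normSq (localize (fun _ => c) Ψ) = 1 := by
      rw [normSq_eq_integral_density]
      simp only [density_localize, integral_const_mul, ← normSq_eq_integral_density, hc2]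
      exact inv_mul_cancel₀ hpos.ne'
    have h1 : groundEnergy N α g Λ m v I
        ≤ ((energy α g Λ m v I (localize (fun _ => c) Ψ) : ℝ) : EReal) :=
      iInf₂_le (localize (fun _ => c) Ψ)
        ⟨localize_mem_core hΨ contDiff_const, hanti.localize fun _ _ => rfl, hnorm⟩
    have h2 := EReal.coe_le_coe_iff.1 (ht.trans h1)
    rw [energy_const_localize hΨ α g hΛ hv hI, hc2, inv_mul_eq_div, le_div_iff₀ hpos] at h2
    exact h2

/-- The data of the localization argument: a symmetric smooth function `G` of the particle
positions whose square is the sum of a one-body density `ρ`. The kinetic and potential energies of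
`G` are bounded by sums of the one-body densities `κ` and `w`, and `r` is half of the gradient
of `ρ`. -/
structure IsLocalizer (v : E3 → ℝ) (G : Config N → ℝ) (ρ κ w : E3 → ℝ) (r : Fin 3 → E3 → ℝ) :
    Prop where
  smooth : ContDiff ℝ ∞ G
  symm : ∀ (π : Equiv.Perm (Fin N)) X, G (X ∘ π) = G X
  sq : ∀ X, G X ^ 2 = ∑ j, ρ (X j)
  grad_sq : ∀ X, ∑ j, ∑ a, lineDeriv ℝ G X (direction j a) ^ 2 ≤ ∑ j, κ (X j)
  mul_grad : ∀ X j a, G X * lineDeriv ℝ G X (direction j a) = r a (X j)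
  potential : ∀ X, externalPotential N v X * G X ^ 2 ≤ ∑ j, w (X j)
  integrable_rho : Integrable ρ
  integrable_kappa : Integrable κ
  integrable_w : Integrable w
  integrable_r : ∀ a, Integrable (r a)
  integral_r : ∀ a, ∫ x, r a x = 0

lemma measurePreserving_shear (j : Fin N) :
    MeasurePreserving (fun p : Config N × E3 => (p.1, p.1 j + p.2))
      (volume.prod volume) (volume.prod volume) :=
  (MeasurePreserving.id volume).skew_product (g := fun (X : Config N) (y : E3) => X j + y)
    (show Measurable fun p : Config N × E3 => p.1 j + p.2 by fun_prop)
    (ae_of_all _ fun X => (measurePreserving_add_left volume (X j)).map_eq)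

lemma integrable_average {r : E3 → ℝ} {s : Config N → ℝ} (hr : Integrable r) (hs : Integrable s)
    (j : Fin N) : Integrable (fun p : Config N × E3 => r (p.1 j + p.2) * s p.1)
      (volume.prod volume) := by
  have h := (measurePreserving_shear j).integrable_comp_of_integrable (hs.mul_prod hr)
  refine h.congr (ae_of_all _ fun p => ?_)
  simp [mul_comm]

lemma integral_average (r : E3 → ℝ) {s : Config N → ℝ} (hr : Integrable r) (hs : Integrable s)
    (j : Fin N) :
    ∫ p : Config N × E3, r (p.1 j + p.2) * s p.1 ∂(volume.prod volume)
      = (∫ x, r x) * ∫ X, s X := by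
  rw [integral_prod _ (integrable_average hr hs j)]
  simp only [integral_mul_const]
  have : ∀ X : Config N, ∫ y, r (X j + y) = ∫ y, r y := fun X =>
    integral_add_left_eq_self r (X j)
  simp only [this, integral_const_mul]

/-- The averaged variational inequality: testing with the translates of `Ψ` multiplied by `G`,
and averaging over the translations. -/
theorem IsLocalizer.groundEnergy_le {v : E3 → ℝ} {G : Config N → ℝ} {ρ κ w : E3 → ℝ}
    {r : Fin 3 → E3 → ℝ} (hG : IsLocalizer v G ρ κ w r) (hN : 1 ≤ N) {α g Λ m : ℝ} (hΛ : 0 < Λ)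
    (hv : LocallyIntegrable v volume) {I : Config N → ℝ} (hI : IsInteraction I) {t : ℝ}
    (ht : (t : EReal) ≤ groundEnergy N α g Λ m v I) {Ψ : State N} (hΨ : Ψ ∈ core N m)
    (hanti : IsAntisymm Ψ) (hnorm : normSq Ψ = 1) :
    t * ∫ x, ρ x ≤ (∫ x, ρ x) * energy α g Λ m 0 I Ψ + (∫ x, κ x) + ∫ x, w x := by
  have hIl := hI.locallyIntegrable
  have hVl := locallyIntegrable_externalPotential (N := N) hv
  have hn : Integrable (density Ψ) := (isRegular_of_mem_core hΨ).integrable_density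
  have he : Integrable (energyDensity α g Λ m I Ψ) := integrable_energyDensity hΨ α g hΛ hIl
  have hc : ∀ j a, Integrable (current α Λ j a Ψ) := integrable_current hΨ α hΛ
  have hE : ∫ X, energyDensity α g Λ m I Ψ X = energy α g Λ m 0 I Ψ := by
    have h0 : externalPotential N (0 : E3 → ℝ) = 0 := by
      funext X
      simp [externalPotential]
    rw [energy_eq_integral hΨ α g hΛ (by rw [h0]; exact locallyIntegrable_zero) hIl, h0, zero_add]
  -- `Q` is the particle density of the trial states and `P` bounds their energy density, both as
  -- functions of the configuration, in the frame translated with the state, and of the translation.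
  set Q : Config N × E3 → ℝ := fun p => ∑ j, ρ (p.1 j + p.2) * density Ψ p.1 with hQdef
  set P : Config N × E3 → ℝ := fun p => ∑ j, (ρ (p.1 j + p.2) * energyDensity α g Λ m I Ψ p.1
    + κ (p.1 j + p.2) * density Ψ p.1 + w (p.1 j + p.2) * density Ψ p.1
    + ∑ a, r a (p.1 j + p.2) * current α Λ j a Ψ p.1) with hPdef
  have hQi : Integrable Q (volume.prod volume) :=
    integrable_finsetSum _ fun j _ => integrable_average hG.integrable_rho hn j
  have h1 := fun j => integrable_average hG.integrable_rho he j
  have h2 := fun j => integrable_average hG.integrable_kappa hn j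
  have h3 := fun j => integrable_average hG.integrable_w hn j
  have h4 := fun j a => integrable_average (hG.integrable_r a) (hc j a) j
  have h12 := fun j => (h1 j).add (h2 j)
  have h123 := fun j => (h12 j).add (h3 j)
  have h4' := fun j => integrable_finsetSum Finset.univ fun a _ => h4 j a
  have h1234 := fun j => (h123 j).add (h4' j)
  have hPi : Integrable P (volume.prod volume) := integrable_finsetSum _ fun j _ => h1234 j
  have hQint : ∫ p, Q p ∂(volume.prod volume) = N * ∫ x, ρ x := by
    rw [hQdef, integral_finsetSum _ fun j _ => integrable_average hG.integrable_rho hn j]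
    simp [integral_average ρ hG.integrable_rho hn, ← normSq_eq_integral_density, hnorm]
  have hPint : ∫ p, P p ∂(volume.prod volume)
      = N * ((∫ x, ρ x) * energy α g Λ m 0 I Ψ + (∫ x, κ x) + ∫ x, w x) := by
    have hj : ∀ j : Fin N, ∫ p : Config N × E3, (ρ (p.1 j + p.2) * energyDensity α g Λ m I Ψ p.1
        + κ (p.1 j + p.2) * density Ψ p.1 + w (p.1 j + p.2) * density Ψ p.1
        + ∑ a, r a (p.1 j + p.2) * current α Λ j a Ψ p.1) ∂(volume.prod volume)
        = (∫ x, ρ x) * energy α g Λ m 0 I Ψ + (∫ x, κ x) + ∫ x, w x := by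
      intro j
      refine (integral_add (h123 j) (h4' j)).trans ?_
      rw [integral_finsetSum _ fun a _ => h4 j a]
      simp only [integral_average _ (hG.integrable_r _) (hc j _), hG.integral_r, zero_mul,
        Finset.sum_const_zero, add_zero]
      refine (integral_add (h12 j) (h3 j)).trans ?_
      rw [integral_average _ hG.integrable_w hn j, ← normSq_eq_integral_density, hnorm, mul_one]
      congr 1
      refine (integral_add (h1 j) (h2 j)).trans ?_
      rw [integral_average _ hG.integrable_rho he j, integral_average _ hG.integrable_kappa hn j,
        ← normSq_eq_integral_density, hnorm, mul_one, hE]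
    refine (integral_finsetSum _ fun j _ => h1234 j).trans ?_
    refine (Finset.sum_congr rfl fun j _ => hj j).trans ?_
    rw [Finset.sum_const, Finset.card_univ, Fintype.card_fin, nsmul_eq_mul]
  have hy : ∀ᵐ y : E3, t * ∫ X, Q (X, y) ≤ ∫ X, P (X, y) := by
    filter_upwards [hPi.prod_left_ae] with y hPy
    have hτ := translate_mem_core hΨ y
    have hΦ := localize_mem_core hτ hG.smooth
    have key := le_energy_of_le_groundEnergy hΛ hv hIl ht hΦ
      ((hanti.translate y).localize hG.symm)
    have hQ : normSq (localize G (translate y Ψ)) = ∫ X, Q (X, y) := by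
      rw [normSq_eq_integral_density, ← integral_shift y]
      simp only [density_localize, density_translate, hG.sq, hQdef, Finset.sum_mul]
      rfl
    rw [hQ] at key
    refine key.trans ?_
    rw [energy_eq_integral hΦ α g hΛ hVl hIl, ← integral_shift y]
    refine integral_mono_ae (integrable_comp_shift y
      (integrable_energyDensity hΦ α g hΛ (hVl.add hIl))) hPy ?_
    have hloc := (measurePreserving_shift (N := N) y).quasiMeasurePreserving.ae
      (energyDensity_localize hτ (hG.smooth.differentiable (by simp)) α g hΛ)
    filter_upwards [hloc, hI.translation y] with X hX hIX
    have hIX' : I (shift y X) = I X := hIX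
    rw [hX, energyDensity_translate]
    have hsplit : energyDensity α g Λ m (fun X => (externalPotential N v + I) (shift y X)) Ψ X
        = energyDensity α g Λ m I Ψ X + externalPotential N v (shift y X) * density Ψ X := by
      simp only [energyDensity, Pi.add_apply, hIX']
      ring
    rw [hsplit, mul_add]
    simp only [density_translate, current_translate, hG.mul_grad, Finset.sum_add_distrib,
      ← Finset.sum_mul, hPdef]
    have hg := mul_le_mul_of_nonneg_right (hG.grad_sq (shift y X)) (density_nonneg Ψ X)
    have hp := mul_le_mul_of_nonneg_right (hG.potential (shift y X)) (density_nonneg Ψ X)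
    rw [hG.sq] at hp ⊢
    simp only [shift] at hg hp ⊢
    linarith
  have hmono := integral_mono_ae (hQi.integral_prod_right.const_mul t) hPi.integral_prod_right hy
  rw [integral_const_mul, ← integral_prod_symm _ hQi, ← integral_prod_symm _ hPi, hQint,
    hPint] at hmono
  have hNpos : (0 : ℝ) < N := by exact_mod_cast hN
  refine le_of_mul_le_mul_left ?_ hNpos
  linarith

/-! ### One-body trial functions -/

lemma schrodingerForm_conj_symm (v : E3 → ℝ) (ψ φ : E3 → ℂ) :
    schrodingerForm v φ ψ = conj (schrodingerForm v ψ φ) := by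
  simp only [schrodingerForm, map_add, map_sum, ← integral_conj, map_mul, Complex.conj_conj,
    Complex.conj_ofReal, mul_comm]

lemma IsTest.sub {ψ φ : E3 → ℂ} (hψ : IsTest ψ) (hφ : IsTest φ) : IsTest (ψ - φ) :=
  ⟨hψ.1.sub hφ.1, hψ.2.sub hφ.2⟩

lemma integrable_conj_partialDeriv_mul {ψ φ : E3 → ℂ} (hψ : IsTest ψ) (hφ : IsTest φ)
    (a : Fin 3) : Integrable fun x => conj (partialDeriv a ψ x) * partialDeriv a φ x :=
  integrable_conj_mul (hψ.lineDeriv _).memLp (hφ.lineDeriv _).memLp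

lemma integrable_potential_mul {v : E3 → ℝ} (hv : LocallyIntegrable v volume) {ψ φ : E3 → ℂ}
    (hψ : IsTest ψ) (hφ : IsTest φ) :
    Integrable fun x => (v x : ℂ) * (conj (ψ x) * φ x) := by
  have hv' : LocallyIntegrable (fun x => (v x : ℂ)) volume := fun x => by
    obtain ⟨U, hU, h⟩ := hv x
    exact ⟨U, hU, Integrable.ofReal h⟩
  have h := hv'.integrable_smul_left_of_hasCompactSupport (g := fun x => conj (ψ x) * φ x)
    ((Complex.continuous_conj.comp hψ.1.continuous).mul hφ.1.continuous) hφ.2.mul_left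
  refine h.congr (ae_of_all _ fun x => ?_)
  simp only [smul_eq_mul]
  ring

lemma schrodingerForm_sub_right {v : E3 → ℝ} (hv : LocallyIntegrable v volume)
    {ψ φ χ : E3 → ℂ} (hψ : IsTest ψ) (hφ : IsTest φ) (hχ : IsTest χ) :
    schrodingerForm v ψ (φ - χ) = schrodingerForm v ψ φ - schrodingerForm v ψ χ := by
  have hd : ∀ a x, partialDeriv a (φ - χ) x = partialDeriv a φ x - partialDeriv a χ x := by
    intro a x
    have d1 := hφ.1.differentiable (by simp) x
    have d2 := hχ.1.differentiable (by simp) x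
    rw [partialDeriv, (d1.sub d2).lineDeriv_eq_fderiv, fderiv_sub d1 d2, partialDeriv,
      partialDeriv, d1.lineDeriv_eq_fderiv, d2.lineDeriv_eq_fderiv]
    rfl
  simp only [schrodingerForm, hd, Pi.sub_apply, mul_sub]
  rw [integral_sub (integrable_potential_mul hv hψ hφ) (integrable_potential_mul hv hψ hχ)]
  have : ∀ a, ∫ x, (conj (partialDeriv a ψ x) * partialDeriv a φ x
      - conj (partialDeriv a ψ x) * partialDeriv a χ x)
      = (∫ x, conj (partialDeriv a ψ x) * partialDeriv a φ x)
        - ∫ x, conj (partialDeriv a ψ x) * partialDeriv a χ x := fun a =>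
    integral_sub (integrable_conj_partialDeriv_mul hψ hφ a)
      (integrable_conj_partialDeriv_mul hψ hχ a)
  simp only [this, Finset.sum_sub_distrib]
  ring

/-- The polarization identity for the form of `p² + v`. -/
lemma schrodingerForm_add_eq {v : E3 → ℝ} (hv : LocallyIntegrable v volume)
    {φ χ : E3 → ℂ} (hφ : IsTest φ) (hχ : IsTest χ) :
    (schrodingerForm v φ φ).re + (schrodingerForm v χ χ).re
      = 2 * (schrodingerForm v φ χ).re + (schrodingerForm v (φ - χ) (φ - χ)).re := by
  rw [schrodingerForm_sub_right hv (hφ.sub hχ) hφ hχ,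
    schrodingerForm_conj_symm v φ (φ - χ), schrodingerForm_conj_symm v χ (φ - χ),
    schrodingerForm_sub_right hv hφ hφ hχ, schrodingerForm_sub_right hv hχ hφ hχ,
    schrodingerForm_conj_symm v φ χ]
  simp only [map_sub, Complex.sub_re, Complex.conj_re, Complex.conj_conj]
  ring

/-- The conclusions of convergence `u n → φ` in `L²` on norms and inner products. -/
lemma tendsto_of_eLpNorm {u : ℕ → E3 → ℂ} {φ : E3 → ℂ} (hu : ∀ n, MemLp (u n) 2 volume)
    (hφ : MemLp φ 2 volume)
    (h : Tendsto (fun n => eLpNorm (u n - φ) 2 volume) atTop (𝓝 0)) :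
    Tendsto (fun n => ∫ x, conj (u n x) * φ x) atTop (𝓝 ((∫ x, ‖φ x‖ ^ 2 : ℝ) : ℂ)) ∧
      Tendsto (fun n => ∫ x, ‖u n x‖ ^ 2) atTop (𝓝 (∫ x, ‖φ x‖ ^ 2)) := by
  have hL : Tendsto (fun n => (hu n).toLp (u n)) atTop (𝓝 (hφ.toLp φ)) := by
    rw [Lp.tendsto_Lp_iff_tendsto_eLpNorm'']
    exact h
  have hin : ∀ {f g : E3 → ℂ} (hf : MemLp f 2 volume) (hg : MemLp g 2 volume),
      inner ℂ (hf.toLp f) (hg.toLp g) = ∫ x, conj (f x) * g x := by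
    intro f g hf hg
    rw [L2.inner_def]
    refine integral_congr_ae ?_
    filter_upwards [hf.coeFn_toLp, hg.coeFn_toLp] with x h1 h2
    rw [h1, h2, RCLike.inner_apply, mul_comm]
  have hself : ∀ {f : E3 → ℂ}, ∫ x, conj (f x) * f x = ((∫ x, ‖f x‖ ^ 2 : ℝ) : ℂ) := by
    intro f
    rw [← integral_complex_ofReal]
    congr 1 with x
    rw [Complex.conj_mul', Complex.ofReal_pow]
  constructor
  · have := hL.inner (tendsto_const_nhds (x := hφ.toLp φ)) (𝕜 := ℂ)
    simpa only [hin, hself] using this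
  · have := (Complex.continuous_re.tendsto _).comp (hL.inner hL (𝕜 := ℂ))
    simpa only [Function.comp_def, hin, hself, Complex.ofReal_re] using this

/-- A bound state of energy `-e₀` is approximated by test functions whose Rayleigh quotient is
almost `-e₀`. Only the polarization identity is used: two late members `u_n`, `u_k` of the
approximating sequence satisfy `q(u_n) + q(u_k) ≈ 2 Re q(u_n, u_k) ≈ -2 e₀ ‖φ‖²`, so that one of
them will do. -/
lemma IsBoundState.exists_isTest {v : E3 → ℝ} (hv : LocallyIntegrable v volume) {e₀ : ℝ}
    (he₀ : 0 < e₀) {φ : E3 → ℂ} (hφ : IsBoundState v (-e₀) φ) {ε : ℝ} (hε : 0 < ε) :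
    ∃ u : E3 → ℂ, IsTest u ∧ 0 < ∫ x, ‖u x‖ ^ 2 ∧
      (schrodingerForm v u u).re ≤ (-e₀ + ε) * ∫ x, ‖u x‖ ^ 2 := by
  obtain ⟨hφL, hφ0, u, hu, hconv, hcauchy, heq⟩ := hφ
  obtain ⟨hin, hnorm⟩ := tendsto_of_eLpNorm (fun n => (hu n).memLp) hφL hconv
  set A := ∫ x, ‖φ x‖ ^ 2 with hA
  have hApos : 0 < A := by
    refine lt_of_le_of_ne (integral_nonneg fun _ => by positivity) fun h0 => hφ0 ?_
    have := (integral_eq_zero_iff_of_nonneg (fun x => by positivity)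
      (hφL.integrable_norm_pow two_ne_zero)).1 h0.symm
    filter_upwards [this] with x hx
    simpa using hx
  have hD : 0 < 1 + e₀ + ε := by positivity
  set ε' := ε * A / (1 + e₀ + ε) with hε'
  have hε'pos : 0 < ε' := by positivity
  have hε'mul : ε' * (1 + e₀ + ε) = ε * A := by rw [hε']; field_simp
  set δ := ε' / (2 + e₀) with hδ
  have hδpos : 0 < δ := by positivity
  have hδmul : δ * (2 + e₀) = ε' := by rw [hδ]; field_simp
  obtain ⟨M, hM⟩ := hcauchy δ hδpos
  have hin' : Tendsto (fun n => (∫ x, conj (u n x) * φ x).re) atTop (𝓝 A) := by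
    have := (Complex.continuous_re.tendsto _).comp hin
    simpa only [Function.comp_def, Complex.ofReal_re] using this
  have hnear : ∀ᶠ n in atTop, |(∫ x, ‖u n x‖ ^ 2) - A| < ε' := by
    have := Metric.tendsto_nhds.1 hnorm ε' hε'pos
    simpa only [Real.dist_eq] using this
  have hinnear : ∀ᶠ n in atTop, |(∫ x, conj (u n x) * φ x).re - A| < δ := by
    have := Metric.tendsto_nhds.1 hin' δ hδpos
    simpa only [Real.dist_eq] using this
  obtain ⟨n, hn1, hn2, hn3⟩ := (hnear.and (hinnear.and (eventually_ge_atTop M))).exists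
  have hq : Tendsto (fun k => (schrodingerForm v (u n) (u k)).re) atTop
      (𝓝 (-e₀ * (∫ x, conj (u n x) * φ x).re)) := by
    have := (Complex.continuous_re.tendsto _).comp (heq (u n) (hu n))
    rwa [Complex.re_ofReal_mul] at this
  have hqnear := Metric.tendsto_nhds.1 hq δ hδpos
  obtain ⟨k, hk1, hk2, hk3⟩ := (hnear.and (hqnear.and (eventually_ge_atTop M))).exists
  rw [Real.dist_eq] at hk2
  have hpol := schrodingerForm_add_eq hv (hu n) (hu k)
  have hsmall := (Complex.re_le_norm _).trans_lt (hM n hn3 k hk3)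
  have h1 := abs_lt.1 hk2
  have h2 := abs_lt.1 hn2
  have h3 : (schrodingerForm v (u n) (u n)).re + (schrodingerForm v (u k) (u k)).re
      ≤ 2 * (-e₀ * A + ε') := by nlinarith
  have hfin : ∀ i, |(∫ x, ‖u i x‖ ^ 2) - A| < ε' →
      (schrodingerForm v (u i) (u i)).re ≤ -e₀ * A + ε' →
      0 < (∫ x, ‖u i x‖ ^ 2) ∧
        (schrodingerForm v (u i) (u i)).re ≤ (-e₀ + ε) * ∫ x, ‖u i x‖ ^ 2 := by
    intro i hi hq
    have h := abs_lt.1 hi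
    constructor
    · nlinarith
    · nlinarith
  rcases le_total (schrodingerForm v (u n) (u n)).re (-e₀ * A + ε') with h | h
  · exact ⟨u n, hu n, hfin n hn1 h⟩
  · exact ⟨u k, hu k, hfin k hk1 (by linarith)⟩

/-- The quadratic form of `p² + v` on real functions. -/
def realForm (v : E3 → ℝ) (ψ : E3 → ℝ) : ℝ :=
  (∑ a : Fin 3, ∫ x, lineDeriv ℝ ψ x (EuclideanSpace.single a 1) ^ 2) + ∫ x, v x * ψ x ^ 2

lemma lineDeriv_clm_comp {ψ : E3 → ℂ} (hψ : IsTest ψ) (T : ℂ →L[ℝ] ℝ) (x e : E3) :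
    lineDeriv ℝ (fun y => T (ψ y)) x e = T (lineDeriv ℝ ψ x e) := by
  have h : HasDerivAt (fun t : ℝ => ψ (x + t • e)) (lineDeriv ℝ ψ x e) 0 :=
    ((hψ.1.differentiable (by simp)) x).lineDifferentiableAt.hasLineDerivAt
  exact (T.hasFDerivAt.comp_hasDerivAt (0 : ℝ) h).deriv

lemma integrable_mul_sq {v : E3 → ℝ} (hv : LocallyIntegrable v volume) {ψ : E3 → ℝ}
    (hψ : Continuous ψ) (hψ' : HasCompactSupport ψ) : Integrable fun x => v x * ψ x ^ 2 := by
  have h := hv.integrable_smul_left_of_hasCompactSupport (g := fun x => ψ x ^ 2)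
    (hψ.pow 2) (hψ'.comp_left (g := fun r => r ^ 2) (by simp))
  refine h.congr (ae_of_all _ fun x => ?_)
  simp only [smul_eq_mul]
  ring

lemma integrable_sq_of_hasCompactSupport {f : E3 → ℝ} (hf : Continuous f)
    (hf' : HasCompactSupport f) : Integrable fun x => f x ^ 2 := by
  have h : HasCompactSupport fun x => f x ^ 2 :=
    hf'.comp_left (g := fun r : ℝ => r ^ 2) (by norm_num)
  exact Continuous.integrable_of_hasCompactSupport (by fun_prop) h

/-- The complex form splits into the forms of real and imaginary part. -/
lemma schrodingerForm_re {v : E3 → ℝ} (hv : LocallyIntegrable v volume) {u : E3 → ℂ}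
    (hu : IsTest u) : (schrodingerForm v u u).re
      = realForm v (fun x => (u x).re) + realForm v (fun x => (u x).im) := by
  have hre : ∀ (x e : E3), lineDeriv ℝ (fun y => (u y).re) x e = (lineDeriv ℝ u x e).re :=
    lineDeriv_clm_comp hu Complex.reCLM
  have him : ∀ (x e : E3), lineDeriv ℝ (fun y => (u y).im) x e = (lineDeriv ℝ u x e).im :=
    lineDeriv_clm_comp hu Complex.imCLM
  have hc := hu.1.continuous
  have hd : ∀ a : Fin 3, (∫ x, conj (partialDeriv a u x) * partialDeriv a u x).re
      = (∫ x, (lineDeriv ℝ u x (EuclideanSpace.single a 1)).re ^ 2)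
        + ∫ x, (lineDeriv ℝ u x (EuclideanSpace.single a 1)).im ^ 2 := by
    intro a
    have ht := hu.lineDeriv (EuclideanSpace.single a 1)
    have h1 : (∫ x, conj (partialDeriv a u x) * partialDeriv a u x).re
        = ∫ x, (conj (partialDeriv a u x) * partialDeriv a u x).re :=
      (integral_re (integrable_conj_partialDeriv_mul hu hu a)).symm
    refine h1.trans (Eq.trans ?_ (integral_add
      (integrable_sq_of_hasCompactSupport (Complex.continuous_re.comp ht.1.continuous)
        (ht.2.comp_left (g := Complex.re) rfl))
      (integrable_sq_of_hasCompactSupport (Complex.continuous_im.comp ht.1.continuous)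
        (ht.2.comp_left (g := Complex.im) rfl))))
    congr 1 with x
    simp [partialDeriv]
    ring
  have hp : (∫ x, (v x : ℂ) * (conj (u x) * u x)).re
      = (∫ x, v x * (u x).re ^ 2) + ∫ x, v x * (u x).im ^ 2 := by
    have h1 : (∫ x, (v x : ℂ) * (conj (u x) * u x)).re
        = ∫ x, ((v x : ℂ) * (conj (u x) * u x)).re :=
      (integral_re (integrable_potential_mul hv hu hu)).symm
    refine h1.trans (Eq.trans ?_ (integral_add
      (integrable_mul_sq hv (Complex.continuous_re.comp hc)
        (hu.2.comp_left (g := Complex.re) rfl))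
      (integrable_mul_sq hv (Complex.continuous_im.comp hc)
        (hu.2.comp_left (g := Complex.im) rfl))))
    congr 1 with x
    simp
    ring
  rw [schrodingerForm, Complex.add_re, Complex.re_sum, hp]
  simp only [hd, realForm, hre, him, Finset.sum_add_distrib]
  ring

lemma IsBoundState.exists_real {v : E3 → ℝ} (hv : LocallyIntegrable v volume) {e₀ : ℝ}
    (he₀ : 0 < e₀) {φ : E3 → ℂ} (hφ : IsBoundState v (-e₀) φ) {ε : ℝ} (hε : 0 < ε) :
    ∃ ψ : E3 → ℝ, ContDiff ℝ ∞ ψ ∧ HasCompactSupport ψ ∧ 0 < ∫ x, ψ x ^ 2 ∧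
      realForm v ψ ≤ (-e₀ + ε) * ∫ x, ψ x ^ 2 := by
  obtain ⟨u, hu, hpos, hle⟩ := hφ.exists_isTest hv he₀ (half_pos hε)
  have h1 : ContDiff ℝ ∞ fun x => (u x).re := Complex.reCLM.contDiff.comp hu.1
  have h2 : ContDiff ℝ ∞ fun x => (u x).im := Complex.imCLM.contDiff.comp hu.1
  have c1 : HasCompactSupport fun x => (u x).re := hu.2.comp_left (g := Complex.re) rfl
  have c2 : HasCompactSupport fun x => (u x).im := hu.2.comp_left (g := Complex.im) rfl
  have hsum : ∫ x, ‖u x‖ ^ 2 = (∫ x, (u x).re ^ 2) + ∫ x, (u x).im ^ 2 := by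
    rw [← integral_add (integrable_sq_of_hasCompactSupport h1.continuous c1)
      (integrable_sq_of_hasCompactSupport h2.continuous c2)]
    congr 1 with x
    rw [← Complex.normSq_eq_norm_sq, Complex.normSq_apply]
    ring
  -- A strict inequality excludes the trivial function.
  have key : ∀ ψ : E3 → ℝ, ContDiff ℝ ∞ ψ → HasCompactSupport ψ →
      realForm v ψ < (-e₀ + ε) * ∫ x, ψ x ^ 2 → 0 < ∫ x, ψ x ^ 2 := by
    intro ψ hψ hψ' hlt
    refine lt_of_le_of_ne (integral_nonneg fun _ => by positivity) fun h0 => ?_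
    have hz := (integral_eq_zero_iff_of_nonneg (fun x => by positivity)
      (integrable_sq_of_hasCompactSupport hψ.continuous hψ')).1 h0.symm
    have hz' : ψ = 0 := by
      refine (hψ.continuous.ae_eq_iff_eq volume continuous_zero).1 ?_
      filter_upwards [hz] with x hx
      simpa using hx
    rw [hz'] at hlt
    simp [realForm, lineDeriv] at hlt
  have hstrict : realForm v (fun x => (u x).re) + realForm v (fun x => (u x).im)
      < (-e₀ + ε) * (∫ x, (u x).re ^ 2) + (-e₀ + ε) * ∫ x, (u x).im ^ 2 := by
    rw [← schrodingerForm_re hv hu, ← mul_add, ← hsum]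
    nlinarith
  rcases lt_or_ge (realForm v fun x => (u x).re) ((-e₀ + ε) * ∫ x, (u x).re ^ 2) with h | h
  · exact ⟨_, h1, c1, key _ h1 c1 h, h.le⟩
  · have h' : realForm v (fun x => (u x).im) < (-e₀ + ε) * ∫ x, (u x).im ^ 2 := by linarith
    exact ⟨_, h2, c2, key _ h2 c2 h', h'.le⟩

/-! ### Localization functions built from one-body functions -/

/-- Smooth real functions on `ℝ³` that are square integrable together with their gradient. -/
structure IsProfile (f : E3 → ℝ) : Prop where
  smooth : ContDiff ℝ ∞ f
  integrable_sq : Integrable fun x => f x ^ 2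
  integrable_deriv_sq : ∀ a : Fin 3,
    Integrable fun x => lineDeriv ℝ f x (EuclideanSpace.single a 1) ^ 2

lemma continuous_lineDeriv {f : E3 → ℝ} (hf : ContDiff ℝ ∞ f) (e : E3) :
    Continuous fun x => lineDeriv ℝ f x e := by
  have h : (fun x => lineDeriv ℝ f x e) = fun x => fderiv ℝ f x e :=
    funext fun x => (hf.differentiable (by simp) x).lineDeriv_eq_fderiv
  rw [h]
  exact (hf.continuous_fderiv (by simp)).clm_apply continuous_const

lemma IsProfile.integrable_mul_deriv {f : E3 → ℝ} (hf : IsProfile f) (a : Fin 3) :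
    Integrable fun x => f x * lineDeriv ℝ f x (EuclideanSpace.single a 1) := by
  refine (hf.integrable_sq.add (hf.integrable_deriv_sq a)).mono'
    (hf.smooth.continuous.mul (continuous_lineDeriv hf.smooth _)).aestronglyMeasurable
    (ae_of_all _ fun x => ?_)
  rw [Real.norm_eq_abs, abs_le]
  simp only [Pi.add_apply]
  constructor <;> nlinarith [sq_nonneg (f x + lineDeriv ℝ f x (EuclideanSpace.single a 1)),
    sq_nonneg (f x - lineDeriv ℝ f x (EuclideanSpace.single a 1)), sq_nonneg (f x),
    sq_nonneg (lineDeriv ℝ f x (EuclideanSpace.single a 1))]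

/-- The gradient of `f²` integrates to zero. -/
lemma IsProfile.integral_mul_deriv {f : E3 → ℝ} (hf : IsProfile f) (a : Fin 3) :
    ∫ x, f x * lineDeriv ℝ f x (EuclideanSpace.single a 1) = 0 := by
  have hd := hf.smooth.differentiable (by simp)
  have h : ∀ x, lineDeriv ℝ f x (EuclideanSpace.single a 1)
      = fderiv ℝ f x (EuclideanSpace.single a 1) := fun x => (hd x).lineDeriv_eq_fderiv
  have hi := hf.integrable_mul_deriv a
  simp only [h] at hi ⊢
  have hi' : Integrable fun x => fderiv ℝ f x (EuclideanSpace.single a 1) * f x :=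
    hi.congr (ae_of_all _ fun x => mul_comm _ _)
  have hsq : Integrable fun x => f x * f x :=
    hf.integrable_sq.congr (ae_of_all _ fun x => sq _)
  have key := integral_mul_fderiv_eq_neg_fderiv_mul_of_integrable hi' hi hsq
    (fun x _ => hd x) (fun x _ => hd x)
  have hcomm : ∫ x, fderiv ℝ f x (EuclideanSpace.single a 1) * f x
      = ∫ x, f x * fderiv ℝ f x (EuclideanSpace.single a 1) := by
    congr 1 with x
    ring
  linarith

lemma isProfile_of_hasCompactSupport {ψ : E3 → ℝ} (hψ : ContDiff ℝ ∞ ψ)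
    (hψ' : HasCompactSupport ψ) : IsProfile ψ where
  smooth := hψ
  integrable_sq := integrable_sq_of_hasCompactSupport hψ.continuous hψ'
  integrable_deriv_sq a := by
    refine integrable_sq_of_hasCompactSupport (continuous_lineDeriv hψ _) ?_
    have h : (fun x => lineDeriv ℝ ψ x (EuclideanSpace.single a 1))
        = fun x => fderiv ℝ ψ x (EuclideanSpace.single a 1) :=
      funext fun x => (hψ.differentiable (by simp) x).lineDeriv_eq_fderiv
    rw [h]
    exact hψ'.fderiv_apply ℝ _

/-- A strictly positive profile, `(1 + |x|²)⁻²`; it need not be normalized. -/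
def tail (x : E3) : ℝ := ((1 + ‖x‖ ^ 2) ^ 2)⁻¹

lemma tail_pos (x : E3) : 0 < tail x := by unfold tail; positivity

lemma contDiff_tail : ContDiff ℝ ∞ tail := by
  unfold tail
  exact ((contDiff_const.add (contDiff_norm_sq ℝ)).pow 2).inv fun x => by positivity

lemma sq_lineDeriv_tail_le (x : E3) (a : Fin 3) :
    lineDeriv ℝ tail x (EuclideanSpace.single a 1) ^ 2 ≤ 16 * tail x ^ 2 := by
  set e : E3 := EuclideanSpace.single a 1 with he
  have he1 : ‖e‖ = 1 := by simp [he]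
  set s : ℝ := 1 + ‖x‖ ^ 2 with hs
  have hs1 : 0 < s := by positivity
  have hl : HasDerivAt (fun t : ℝ => x + t • e) e 0 := by
    simpa using ((hasDerivAt_id (0 : ℝ)).smul_const e).const_add x
  have h1 : HasDerivAt (fun t : ℝ => 1 + ‖x + t • e‖ ^ 2) (2 * inner ℝ x e) 0 := by
    simpa using (hl.norm_sq).const_add 1
  have h2 := (h1.fun_pow 2).fun_inv (by positivity)
  have h3 : lineDeriv ℝ tail x e = _ := h2.deriv
  have hin : |inner ℝ x e| ≤ s := by
    refine (abs_real_inner_le_norm x e).trans ?_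
    rw [he1, mul_one, hs]
    nlinarith [sq_nonneg (‖x‖ - 1)]
  have h4 : lineDeriv ℝ tail x e = -(4 * inner ℝ x e) * (s ^ 3)⁻¹ := by
    rw [h3]
    simp only [zero_smul, add_zero, ← hs]
    field_simp
    ring
  have hin2 : inner ℝ x e ^ 2 ≤ s ^ 2 := sq_le_sq' (abs_le.1 hin).1 (abs_le.1 hin).2
  rw [h4, show tail x = (s ^ 2)⁻¹ from rfl]
  calc (-(4 * inner ℝ x e) * (s ^ 3)⁻¹) ^ 2 = 16 * (inner ℝ x e ^ 2 * ((s ^ 3)⁻¹) ^ 2) := by ring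
    _ ≤ 16 * (s ^ 2 * ((s ^ 3)⁻¹) ^ 2) := by gcongr
    _ = 16 * ((s ^ 2)⁻¹) ^ 2 := by field_simp

lemma isProfile_tail : IsProfile tail := by
  have hsq : Integrable fun x => tail x ^ 2 := by
    have h := integrable_rpow_neg_one_add_norm_sq (E := E3) (μ := volume) (r := 8)
      (by simp; norm_num)
    refine h.congr (ae_of_all _ fun x => ?_)
    have h0 : (0 : ℝ) ≤ 1 + ‖x‖ ^ 2 := by positivity
    simp only [tail]
    rw [show (-8 / 2 : ℝ) = -((4 : ℕ) : ℝ) by norm_num, Real.rpow_neg h0, Real.rpow_natCast,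
      inv_pow, ← pow_mul]
  refine ⟨contDiff_tail, hsq, fun a => ?_⟩
  refine (hsq.const_mul 16).mono'
    ((continuous_lineDeriv contDiff_tail _).pow 2).aestronglyMeasurable (ae_of_all _ fun x => ?_)
  rw [Real.norm_of_nonneg (sq_nonneg _)]
  exact sq_lineDeriv_tail_le x a

lemma realForm_eq {v : E3 → ℝ} {ψ : E3 → ℝ} (hψ : IsProfile ψ) :
    realForm v ψ = (∫ x, ∑ a : Fin 3, lineDeriv ℝ ψ x (EuclideanSpace.single a 1) ^ 2)
      + ∫ x, v x * ψ x ^ 2 := by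
  rw [realForm, integral_finsetSum _ fun a _ => hψ.integrable_deriv_sq a]

/-- For one particle a test function itself is a localization function. -/
lemma isLocalizer_one {v : E3 → ℝ} (hv : LocallyIntegrable v volume) {ψ : E3 → ℝ}
    (hψ : ContDiff ℝ ∞ ψ) (hψ' : HasCompactSupport ψ) :
    IsLocalizer (N := 1) v (fun X => ψ (X 0)) (fun x => ψ x ^ 2)
      (fun x => ∑ a : Fin 3, lineDeriv ℝ ψ x (EuclideanSpace.single a 1) ^ 2)
      (fun x => v x * ψ x ^ 2)
      (fun a x => ψ x * lineDeriv ℝ ψ x (EuclideanSpace.single a 1)) := by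
  have hp := isProfile_of_hasCompactSupport hψ hψ'
  have hd : ∀ (X : Config 1) (j : Fin 1) (a : Fin 3),
      lineDeriv ℝ (fun X : Config 1 => ψ (X 0)) X (direction j a)
        = lineDeriv ℝ ψ (X 0) (EuclideanSpace.single a 1) := by
    intro X j a
    rw [Subsingleton.elim j 0]
    simp [lineDeriv]
  exact
    { smooth := hψ.comp (contDiff_apply ℝ E3 (0 : Fin 1))
      symm := fun π X => by simp [Subsingleton.elim (π 0) 0]
      sq := fun X => by simp
      grad_sq := fun X => by simp [hd]
      mul_grad := fun X j a => by rw [hd, Subsingleton.elim j 0]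
      potential := fun X => by simp [externalPotential]
      integrable_rho := hp.integrable_sq
      integrable_kappa := integrable_finsetSum _ fun a _ => hp.integrable_deriv_sq a
      integrable_w := integrable_mul_sq hv hψ.continuous hψ'
      integrable_r := hp.integrable_mul_deriv
      integral_r := hp.integral_mul_deriv }

/-- For a nonpositive potential and any number of particles, the localization function is
`G = (∑_j ρ(x_j))^{1/2}`. The summand `d η²` of `ρ = ψ² + d η²`, with `η > 0`, makes it smooth.
The gradient is controlled by `|∇√ρ|² ≤ |∇ψ|² + d |∇η|²`, and the potential energy by dropping
from `∑_j v(x_j) ∑_k ρ(x_k)` all terms other than `v(x_j) ψ(x_j)²`, which are nonpositive. -/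
lemma isLocalizer_sqrt {N : ℕ} (hN : 1 ≤ N) {v : E3 → ℝ} (hv : LocallyIntegrable v volume)
    (hv0 : ∀ x, v x ≤ 0) {ψ : E3 → ℝ} (hψ : ContDiff ℝ ∞ ψ) (hψ' : HasCompactSupport ψ)
    {d : ℝ} (hd : 0 < d) :
    IsLocalizer (N := N) v (fun X => √(∑ j, (ψ (X j) ^ 2 + d * tail (X j) ^ 2)))
      (fun x => ψ x ^ 2 + d * tail x ^ 2)
      (fun x => (∑ a : Fin 3, lineDeriv ℝ ψ x (EuclideanSpace.single a 1) ^ 2)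
        + d * ∑ a : Fin 3, lineDeriv ℝ tail x (EuclideanSpace.single a 1) ^ 2)
      (fun x => v x * ψ x ^ 2)
      (fun a x => ψ x * lineDeriv ℝ ψ x (EuclideanSpace.single a 1)
        + d * (tail x * lineDeriv ℝ tail x (EuclideanSpace.single a 1))) := by
  have hp := isProfile_of_hasCompactSupport hψ hψ'
  have ht := isProfile_tail
  set ρ : E3 → ℝ := fun x => ψ x ^ 2 + d * tail x ^ 2 with hρ
  set r : Fin 3 → E3 → ℝ := fun a x => ψ x * lineDeriv ℝ ψ x (EuclideanSpace.single a 1)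
        + d * (tail x * lineDeriv ℝ tail x (EuclideanSpace.single a 1)) with hr
  have hρpos : ∀ x, 0 < ρ x := fun x => by have := tail_pos x; simp only [hρ]; positivity
  have hle : ∀ (X : Config N) j, ρ (X j) ≤ ∑ i, ρ (X i) := fun X j =>
    Finset.single_le_sum (fun i _ => (hρpos (X i)).le) (Finset.mem_univ j)
  have hS : ∀ X : Config N, 0 < ∑ i, ρ (X i) := fun X =>
    (hρpos (X ⟨0, hN⟩)).trans_le (hle X _)
  have hρs : ContDiff ℝ ∞ ρ := (hψ.pow 2).add (contDiff_const.mul (contDiff_tail.pow 2))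
  have hρd : ∀ (x : E3) a,
      HasDerivAt (fun t : ℝ => ρ (x + t • EuclideanSpace.single a 1)) (2 * r a x) 0 := by
    intro x a
    have h1 : HasDerivAt (fun t : ℝ => ψ (x + t • EuclideanSpace.single a 1)) _ 0 :=
      (hψ.differentiable (by simp) x).lineDifferentiableAt.hasLineDerivAt
    have h2 : HasDerivAt (fun t : ℝ => tail (x + t • EuclideanSpace.single a 1)) _ 0 :=
      (contDiff_tail.differentiable (by simp) x).lineDifferentiableAt.hasLineDerivAt
    refine ((h1.fun_pow 2).fun_add ((h2.fun_pow 2).const_mul d)).congr_deriv ?_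
    simp only [zero_smul, add_zero, hr, Nat.cast_ofNat, Nat.add_one_sub_one, pow_one]
    ring
  have hGd : ∀ (X : Config N) (j : Fin N) (a : Fin 3),
      lineDeriv ℝ (fun X : Config N => √(∑ i, ρ (X i))) X (direction j a)
        = r a (X j) / √(∑ i, ρ (X i)) := by
    intro X j a
    have h1 : ∀ i, HasDerivAt (fun t : ℝ => ρ ((X + t • direction j a) i))
        (if i = j then 2 * r a (X j) else 0) 0 := by
      intro i
      split_ifs with h
      · subst h
        simpa using hρd (X i) a
      · simpa [h] using hasDerivAt_const (0 : ℝ) (ρ (X i))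
    have h2 := HasDerivAt.fun_sum (u := Finset.univ) fun i _ => h1 i
    have h3 := h2.sqrt (by simpa using (hS X).ne')
    have h4 : lineDeriv ℝ (fun X : Config N => √(∑ i, ρ (X i))) X (direction j a) = _ := h3.deriv
    rw [h4]
    simp only [Finset.sum_ite_eq', Finset.mem_univ, if_true, zero_smul, add_zero]
    exact mul_div_mul_left _ _ two_ne_zero
  have hCS : ∀ a x, r a x ^ 2 ≤ ρ x * (lineDeriv ℝ ψ x (EuclideanSpace.single a 1) ^ 2
      + d * lineDeriv ℝ tail x (EuclideanSpace.single a 1) ^ 2) := by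
    intro a x
    simp only [hr, hρ]
    have := mul_nonneg hd.le (sq_nonneg (ψ x * lineDeriv ℝ tail x (EuclideanSpace.single a 1)
      - tail x * lineDeriv ℝ ψ x (EuclideanSpace.single a 1)))
    nlinarith
  exact
    { smooth := (ContDiff.sum fun i _ => hρs.comp (contDiff_apply ℝ E3 i)).sqrt
        fun X => (hS X).ne'
      symm := fun π X => by
        congr 1
        exact Equiv.sum_comp π fun i => ρ (X i)
      sq := fun X => Real.sq_sqrt (hS X).le
      grad_sq := fun X => by
        refine Finset.sum_le_sum fun j _ => ?_
        rw [Finset.mul_sum, ← Finset.sum_add_distrib]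
        refine Finset.sum_le_sum fun a _ => ?_
        rw [hGd, div_pow, Real.sq_sqrt (hS X).le, div_le_iff₀ (hS X), mul_comm]
        exact (hCS a (X j)).trans (mul_le_mul_of_nonneg_right (hle X j) (by positivity))
      mul_grad := fun X j a => by
        rw [hGd]
        exact mul_div_cancel₀ _ (Real.sqrt_pos.2 (hS X)).ne'
      potential := fun X => by
        rw [Real.sq_sqrt (hS X).le, externalPotential, Finset.sum_mul]
        refine Finset.sum_le_sum fun j _ => mul_le_mul_of_nonpos_left ?_ (hv0 _)
        refine le_trans ?_ (hle X j)
        have := tail_pos (X j)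
        simp only [hρ]
        nlinarith [mul_pos hd (pow_pos this 2)]
      integrable_rho := hp.integrable_sq.add (ht.integrable_sq.const_mul d)
      integrable_kappa := (integrable_finsetSum _ fun a _ => hp.integrable_deriv_sq a).add
        ((integrable_finsetSum _ fun a _ => ht.integrable_deriv_sq a).const_mul d)
      integrable_w := integrable_mul_sq hv hψ.continuous hψ'
      integrable_r := fun a => (hp.integrable_mul_deriv a).add
        ((ht.integrable_mul_deriv a).const_mul d)
      integral_r := fun a => by
        rw [hr]
        simp only
        rw [integral_add (hp.integrable_mul_deriv a) ((ht.integrable_mul_deriv a).const_mul d),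
          integral_const_mul, hp.integral_mul_deriv, ht.integral_mul_deriv, mul_zero, add_zero] }

/-! ### Binding -/

/-- Binding follows from the averaged variational inequality for test functions `ψ`. -/
lemma groundEnergy_le_of_forall_test {N : ℕ} {α g Λ m : ℝ} {v : E3 → ℝ}
    (hv : LocallyIntegrable v volume) {e₀ : ℝ} (he₀ : 0 < e₀) {φ : E3 → ℂ}
    (hφ : IsBoundState v (-e₀) φ) {I : Config N → ℝ}
    (h : ∀ ψ : E3 → ℝ, ContDiff ℝ ∞ ψ → HasCompactSupport ψ → ∀ t : ℝ,
      (t : EReal) ≤ groundEnergy N α g Λ m v I → ∀ Ψ ∈ core N m, IsAntisymm Ψ → normSq Ψ = 1 →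
        t * ∫ x, ψ x ^ 2 ≤ (∫ x, ψ x ^ 2) * energy α g Λ m 0 I Ψ + realForm v ψ) :
    groundEnergy N α g Λ m v I ≤ groundEnergy N α g Λ m 0 I - (e₀ : EReal) := by
  rw [EReal.le_sub_iff_add_le (Or.inl (EReal.coe_ne_bot _)) (Or.inl (EReal.coe_ne_top _))]
  refine le_iInf₂ fun Ψ ⟨hΨ, hanti, hnorm⟩ => ?_
  rw [← EReal.le_sub_iff_add_le (Or.inl (EReal.coe_ne_bot _)) (Or.inl (EReal.coe_ne_top _)),
    ← EReal.coe_sub]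
  refine EReal.ge_of_forall_gt_iff_ge.1 fun t ht => EReal.coe_le_coe_iff.2 ?_
  refine le_of_forall_pos_le_add fun ε hε => ?_
  obtain ⟨ψ, hψ, hψ', hpos, hle⟩ := hφ.exists_real hv he₀ hε
  have := h ψ hψ hψ' t ht.le Ψ hΨ hanti hnorm
  refine le_of_mul_le_mul_right ?_ hpos
  linarith

end
end QED

theorem theorem3p1
    (α g Λ m : ℝ) (hα : 0 ≤ α) (hΛ : 0 < Λ) (hm : 0 ≤ m)
    (v : QED.E3 → ℝ) (hv : MeasureTheory.LocallyIntegrable v MeasureTheory.volume)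
    (hv_neg : QED.NegPartFormBounded v)
    (e₀ : ℝ) (he₀ : 0 < e₀)
    (φ : QED.E3 → ℂ) (hφ : QED.IsBoundState v (-e₀) φ) :
    (∀ I : QED.Config 1 → ℝ, QED.IsInteraction I →
      QED.groundEnergy 1 α g Λ m v I ≤ QED.groundEnergy 1 α g Λ m 0 I - (e₀ : EReal)) ∧
    ((∀ x, v x ≤ 0) →
      ∀ N : ℕ, 1 ≤ N → ∀ I : QED.Config N → ℝ, QED.IsInteraction I →
        QED.groundEnergy N α g Λ m v I ≤ QED.groundEnergy N α g Λ m 0 I - (e₀ : EReal)) := by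
  refine ⟨fun I hI => ?_, fun hv0 N hN I hI => ?_⟩
  · refine QED.groundEnergy_le_of_forall_test hv he₀ hφ fun ψ hψ hψ' t ht Ψ hΨ hanti hnorm => ?_
    have := (QED.isLocalizer_one hv hψ hψ').groundEnergy_le le_rfl hΛ hv hI ht hΨ hanti hnorm
    rw [QED.realForm_eq (QED.isProfile_of_hasCompactSupport hψ hψ')]
    linarith
  · refine QED.groundEnergy_le_of_forall_test hv he₀ hφ fun ψ hψ hψ' t ht Ψ hΨ hanti hnorm => ?_
    have hp := QED.isProfile_of_hasCompactSupport hψ hψ'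
    have hq := QED.isProfile_tail
    -- The inequality for `ρ = ψ² + d η²` is affine in `d > 0`; its limit `d → 0` is the claim.
    have key : ∀ d : ℝ, 0 < d → t * ((∫ x, ψ x ^ 2) + d * ∫ x, QED.tail x ^ 2)
        ≤ ((∫ x, ψ x ^ 2) + d * ∫ x, QED.tail x ^ 2) * QED.energy α g Λ m 0 I Ψ
          + ((∫ x, ∑ a : Fin 3, lineDeriv ℝ ψ x (EuclideanSpace.single a 1) ^ 2)
            + d * ∫ x, ∑ a : Fin 3, lineDeriv ℝ QED.tail x (EuclideanSpace.single a 1) ^ 2)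
          + ∫ x, v x * ψ x ^ 2 := by
      intro d hd
      have := (QED.isLocalizer_sqrt hN hv hv0 hψ hψ' hd).groundEnergy_le hN hΛ hv hI ht hΨ
        hanti hnorm
      rw [MeasureTheory.integral_add hp.integrable_sq (hq.integrable_sq.const_mul d),
        MeasureTheory.integral_add
          (MeasureTheory.integrable_finsetSum _ fun a _ => hp.integrable_deriv_sq a)
          ((MeasureTheory.integrable_finsetSum _ fun a _ =>
            hq.integrable_deriv_sq a).const_mul d),
        MeasureTheory.integral_const_mul, MeasureTheory.integral_const_mul] at this
      exact this
    rw [QED.realForm_eq hp]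
    set C : ℝ := (∫ x, QED.tail x ^ 2) * QED.energy α g Λ m 0 I Ψ
      + (∫ x, ∑ a : Fin 3, lineDeriv ℝ QED.tail x (EuclideanSpace.single a 1) ^ 2)
      - t * ∫ x, QED.tail x ^ 2 with hC
    refine le_of_forall_pos_le_add fun ε hε => ?_
    have hd : 0 < ε / (|C| + 1) := by positivity
    have h1 := key _ hd
    have h2 : ε / (|C| + 1) * C ≤ ε := by
      calc ε / (|C| + 1) * C ≤ ε / (|C| + 1) * (|C| + 1) := by
            gcongr
            linarith [le_abs_self C]
        _ = ε := div_mul_cancel₀ _ (by positivity)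
    rw [hC] at h2
    linarith
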